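/- Let $K=\mathbb{F}_2(t)$, let $\omega$ be a place of $K$ (a monic irreducible polynomial of $\mathbb{F}_2[t]$ or the place at infinity), and let $K_\omega$ be the completion of $K$ at $\omega$. For $a\in K_\omega$ and $b\in K_\omega^\times$ let $[a,b)=b\cup\delta\varphi_a\in \mathrm{Br}\,K_\omega=H^2(\mathrm{Gal}(K_\omega^{s}/K_\omega),(K_\omega^{s})^\times)$ be Serre's symbol, where $\varphi_a(\sigma)=\sigma(\alpha)-\alpha\in\mathbb{Z}/2\mathbb{Z}\cong\tfrac12\mathbb{Z}/\mathbb{Z}\subset\mathbb{Q}/\mathbb{Z}$ is the Artin--Schreier character attached to a root $\alpha\in K_\omega^s$ of $\alpha^2-\alpha=a$ and $\delta\colon H^1(\mathrm{Gal}(K_\omega^{s}/K_\omega),\mathbb{Q}/\mathbb{Z})\to H^2(\mathrm{Gal}(K_\omega^{s}/K_\omega),\mathbb{Z})$ is the connecting homomorphism. Put $[a,b)_\omega=2\cdot\mathrm{inv}_\omega[a,b)\in\mathbb{Z}/2\mathbb{Z}$, where $\mathrm{inv}_\omega\colon\mathrm{Br}\,K_\omega\to\mathbb{Q}/\mathbb{Z}$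 is the local invariant. For $y\in K_\omega$ let $C_y\subset\mathbb{P}^2_{K_\omega}$ be the conic $$x_0^2+x_0x_1+yx_1^2=tx_2^2,$$ and let $L_\omega=K_\omega[a]/(a^2-a-y)$ be the Artin--Schreier algebra (a quadratic étale $K_\omega$-algebra, which is $K_\omega\times K_\omega$ if $a^2-a-y$ is reducible). Then for every place $\omega$ of $K$ and every $y\in K_\omega$ we have $C_y(K_\omega)\neq\emptyset$ if and only if $[y,t)_\omega=0$, and this holds if and only if $t$ is a norm from $L_\omega$, i.e. $t=N_{L_\omega/K_\omega}(z)$ for some $z\in L_\omega$. -/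

import Mathlib

open Polynomial
open scoped WithZero

noncomputable section

/-! ## Galois cohomological Brauer group -/

section Brauer

/-- A separable closure of `k`. (A wrapper of Mathlib's `SeparableClosure`, so that its field
structure is not unfolded by instance search.) -/
def SepCl (k : Type*) [Field k] : Type _ := SeparableClosure k

instance (k : Type*) [Field k] : Field (SepCl k) := inferInstanceAs (Field (SeparableClosure k))

instance (k : Type*) [Field k] : Algebra k (SepCl k) :=
  inferInstanceAs (Algebra k (SeparableClosure k))

instance (k : Type*) [Field k] : IsSepClosure k (SepCl k) :=
  inferInstanceAs (IsSepClosure k (SeparableClosure k))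

instance (k : Type*) [Field k] : IsSepClosed (SepCl k) := IsSepClosure.sep_closed k

/-- The absolute Galois group of `k` (automorphisms of a separable closure), with its Krull
topology. -/
abbrev AbsGal (k : Type*) [Field k] : Type _ :=
  SepCl k ≃ₐ[k] SepCl k

/-- Continuous 2-cocycles of the absolute Galois group with values in the discrete module
`(kˢ)ˣ`. -/
def brauerCocycles (k : Type*) [Field k] :
    Subgroup (AbsGal k × AbsGal k → (SepCl k)ˣ) where
  carrier := {f | IsLocallyConstant f ∧ groupCohomology.IsMulCocycle₂ f}
  one_mem' := ⟨IsLocallyConstant.const 1, fun g h j => by simp⟩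
  mul_mem' := by
    rintro f f' ⟨hf, hf2⟩ ⟨hf', hf2'⟩
    refine ⟨hf.mul hf', fun g h j => ?_⟩
    have e1 := hf2 g h j
    have e2 := hf2' g h j
    simp only [Pi.mul_apply, smul_mul']
    rw [mul_mul_mul_comm, e1, e2, mul_mul_mul_comm]
  inv_mem' := by
    rintro f ⟨hf, hf2⟩
    refine ⟨hf.inv, fun g h j => ?_⟩
    have e1 := hf2 g h j
    simp only [Pi.inv_apply, smul_inv']
    rw [← mul_inv, e1, mul_inv]

/-- Coboundaries of continuous 1-cochains of the absolute Galois group with values in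
`(kˢ)ˣ`. -/
def brauerCoboundaries (k : Type*) [Field k] :
    Subgroup (AbsGal k × AbsGal k → (SepCl k)ˣ) where
  carrier := {f | ∃ x : AbsGal k → (SepCl k)ˣ, IsLocallyConstant x ∧
    ∀ g h : AbsGal k, g • x h / x (g * h) * x g = f (g, h)}
  one_mem' := ⟨1, IsLocallyConstant.const 1, fun g h => by simp⟩
  mul_mem' := by
    rintro f f' ⟨x, hx, hf⟩ ⟨x', hx', hf'⟩
    refine ⟨x * x', hx.mul hx', fun g h => ?_⟩
    simp only [Pi.mul_apply, smul_mul', ← hf, ← hf']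
    rw [mul_div_mul_comm, mul_mul_mul_comm]
  inv_mem' := by
    rintro f ⟨x, hx, hf⟩
    refine ⟨x⁻¹, hx.inv, fun g h => ?_⟩
    simp only [Pi.inv_apply, smul_inv', ← hf]
    rw [mul_inv, inv_div_inv, inv_div]

/-- The Brauer group `Br k = H²(Gal(kˢ/k), (kˢ)ˣ)`, written multiplicatively. -/
abbrev Br (k : Type*) [Field k] : Type _ :=
  brauerCocycles k ⧸ (brauerCoboundaries k).subgroupOf (brauerCocycles k)

/-- The group `ℚ/ℤ`. -/
abbrev QmodZ : Type := AddCircle (1 : ℚ)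

/-- Continuous characters of the absolute Galois group with values in the discrete group
`ℚ/ℤ`. -/
structure GalChar (k : Type*) [Field k] where
  /-- The underlying homomorphism. -/
  toHom : AbsGal k →* Multiplicative QmodZ
  isOpen_ker : IsOpen (toHom.ker : Set (AbsGal k))

variable {k : Type*} [Field k]

/-- The lift of a character to a function with values in `[0, 1) ⊆ ℚ`. -/
def GalChar.lift (χ : GalChar k) (σ : AbsGal k) : ℚ :=
  (AddCircle.equivIco (1 : ℚ) 0 (χ.toHom σ).toAdd : ℚ)

theorem GalChar.coe_lift (χ : GalChar k) (σ : AbsGal k) :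
    ((χ.lift σ : ℚ) : QmodZ) = (χ.toHom σ).toAdd :=
  AddCircle.coe_equivIco

/-- The 2-cocycle `(σ, τ) ↦ χ̃(τ) - χ̃(στ) + χ̃(σ) ∈ ℤ` which represents the image of `χ`
under the connecting homomorphism `δ : H¹(ℚ/ℤ) → H²(ℤ)`. The rational number inside the floor
is an integer, see `GalChar.coe_delta`. -/
def GalChar.delta (χ : GalChar k) (σ τ : AbsGal k) : ℤ :=
  ⌊χ.lift τ - χ.lift (σ * τ) + χ.lift σ⌋

theorem GalChar.coe_delta (χ : GalChar k) (σ τ : AbsGal k) :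
    (χ.delta σ τ : ℚ) = χ.lift τ - χ.lift (σ * τ) + χ.lift σ := by
  have h : ((χ.lift τ - χ.lift (σ * τ) + χ.lift σ : ℚ) : QmodZ) = 0 := by
    rw [AddCircle.coe_add, AddCircle.coe_sub, χ.coe_lift, χ.coe_lift, χ.coe_lift, map_mul,
      toAdd_mul]
    abel
  obtain ⟨n, hn⟩ := (AddCircle.coe_eq_zero_iff (1 : ℚ)).1 h
  rw [GalChar.delta, ← hn]
  simp

theorem GalChar.isLocallyConstant (χ : GalChar k) : IsLocallyConstant χ.toHom := by
  rw [IsLocallyConstant.iff_exists_open]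
  intro σ
  refine ⟨(fun τ => σ⁻¹ * τ) ⁻¹' (χ.toHom.ker : Set (AbsGal k)),
    χ.isOpen_ker.preimage (continuous_const_mul _), by simp, fun τ hτ => ?_⟩
  have h : χ.toHom (σ⁻¹ * τ) = 1 := hτ
  rw [map_mul, map_inv, inv_mul_eq_one] at h
  exact h.symm

/-- The class `(χ, b) = b ∪ δχ ∈ Br k` for `b ∈ kˣ = H⁰(Gal(kˢ/k), (kˢ)ˣ)`. -/
def GalChar.cup (χ : GalChar k) (b : kˣ) : Br k :=
  QuotientGroup.mk ⟨fun p => Units.map (algebraMap k (SepCl k)) b ^ χ.delta p.1 p.2, by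
    constructor
    · have hl : IsLocallyConstant χ.lift :=
        χ.isLocallyConstant.comp
          (fun c : Multiplicative QmodZ => (AddCircle.equivIco (1 : ℚ) 0 c.toAdd : ℚ))
      have h1 : IsLocallyConstant fun p : AbsGal k × AbsGal k => χ.lift p.2 :=
        hl.comp_continuous continuous_snd
      have h2 : IsLocallyConstant fun p : AbsGal k × AbsGal k => χ.lift (p.1 * p.2) :=
        hl.comp_continuous continuous_mul
      have h3 : IsLocallyConstant fun p : AbsGal k × AbsGal k => χ.lift p.1 :=
        hl.comp_continuous continuous_fst
      exact ((h1.sub h2).add h3).comp fun r : ℚ =>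
        Units.map (algebraMap k (SepCl k)).toMonoidHom b ^ ⌊r⌋
    · intro g h j
      have hg : g • Units.map (algebraMap k (SepCl k)).toMonoidHom b =
          Units.map (algebraMap k (SepCl k)).toMonoidHom b := by
        ext1
        simp
      have hd : χ.delta (g * h) j + χ.delta g h = χ.delta h j + χ.delta g (h * j) := by
        have : ((χ.delta (g * h) j + χ.delta g h : ℤ) : ℚ) =
            ((χ.delta h j + χ.delta g (h * j) : ℤ) : ℚ) := by
          push_cast
          simp only [χ.coe_delta, mul_assoc]
          ring
        exact_mod_cast this
      change _ ^ _ * _ ^ _ = g • (_ ^ _) * _ ^ _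
      rw [smul_zpow', ← zpow_add, hd, zpow_add]
      exact congrArg (fun u => u ^ _ * _) hg.symm⟩

end Brauer

/-! ## Artin–Schreier characters in characteristic two and the symbol `[a, b)` -/

section ArtinSchreier

variable {k : Type*} [Field k] [CharP k 2]

theorem exists_artinSchreierRoot (a : k) :
    ∃ α : SepCl k, α ^ 2 - α = algebraMap k (SepCl k) a := by
  have : CharP (SepCl k) 2 :=
    charP_of_injective_algebraMap (algebraMap k (SepCl k)).injective 2
  let p : (SepCl k)[X] := X ^ 2 - X - C (algebraMap k _ a)
  have hdeg : p.degree = 2 := by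
    simp only [p]
    compute_degree!
  have hsep : p.Separable := by
    have hd : derivative p = -1 := by
      simp only [p, derivative_sub, derivative_X_pow, derivative_X, derivative_C]
      have h2 : ((2 : ℕ) : SepCl k) = 0 := CharP.cast_eq_zero _ 2
      rw [h2]
      simp
    rw [Polynomial.separable_def, hd]
    exact isCoprime_one_right.neg_right
  obtain ⟨α, hα⟩ := IsSepClosed.exists_root p (by rw [hdeg]; norm_num) hsep
  refine ⟨α, ?_⟩
  have : α ^ 2 - α - algebraMap k (SepCl k) a = 0 := by
    simpa [p, IsRoot] using hα
  exact sub_eq_zero.1 this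

/-- A root `α` of `α² - α = a` in the separable closure. -/
def artinSchreierRoot (a : k) : SepCl k :=
  (exists_artinSchreierRoot a).choose

theorem artinSchreierRoot_spec (a : k) :
    artinSchreierRoot a ^ 2 - artinSchreierRoot a = algebraMap k (SepCl k) a :=
  (exists_artinSchreierRoot a).choose_spec

theorem artinSchreierRoot_apply (a : k) (σ : AbsGal k) :
    σ (artinSchreierRoot a) = artinSchreierRoot a ∨
      σ (artinSchreierRoot a) = artinSchreierRoot a + 1 := by
  have h := artinSchreierRoot_spec a
  have h' := congrArg σ h
  rw [map_sub, map_pow, AlgEquiv.commutes, ← h] at h'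
  have h2 : (2 : SepCl k) = 0 := by
    have : CharP (SepCl k) 2 :=
      charP_of_injective_algebraMap (algebraMap k (SepCl k)).injective 2
    exact_mod_cast CharP.cast_eq_zero (SepCl k) 2
  have hm : (σ (artinSchreierRoot a) - artinSchreierRoot a) *
      (σ (artinSchreierRoot a) - (artinSchreierRoot a + 1)) = 0 := by
    linear_combination h' + (artinSchreierRoot a ^ 2
      - σ (artinSchreierRoot a) * artinSchreierRoot a) * h2
  rcases mul_eq_zero.1 hm with h | h
  · exact Or.inl (sub_eq_zero.1 h)
  · exact Or.inr (sub_eq_zero.1 h)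

/-- The Artin–Schreier character `φ_a(σ) = σ(α) - α ∈ ℤ/2ℤ` with `α² - α = a`, where `ℤ/2ℤ` is
identified with `(1/2)ℤ/ℤ ⊆ ℚ/ℤ`. -/
def artinSchreierChar (a : k) : GalChar k where
  toHom :=
    { toFun := fun σ =>
        open Classical in
        if σ (artinSchreierRoot a) = artinSchreierRoot a then 1
        else Multiplicative.ofAdd (((1 / 2 : ℚ) : ℚ) : QmodZ)
      map_one' := by simp
      map_mul' := fun σ τ => by
        have h2 : (1 : SepCl k) + 1 = 0 := by
          have : CharP (SepCl k) 2 :=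
            charP_of_injective_algebraMap (algebraMap k (SepCl k)).injective 2
          exact CharTwo.add_self_eq_zero 1
        have hh : Multiplicative.ofAdd (((1 / 2 : ℚ) : ℚ) : QmodZ) *
            Multiplicative.ofAdd (((1 / 2 : ℚ) : ℚ) : QmodZ) = 1 := by
          rw [← ofAdd_add, ← AddCircle.coe_add, add_halves, AddCircle.coe_period, ofAdd_zero]
        rw [AlgEquiv.mul_apply]
        rcases artinSchreierRoot_apply a σ with hσ | hσ <;>
          rcases artinSchreierRoot_apply a τ with hτ | hτ
        · simp [hσ, hτ]
        · simp [hσ, hτ]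
        · simp [hσ, hτ]
        · have : artinSchreierRoot a + 1 + 1 = artinSchreierRoot a := by
            rw [add_assoc, h2, add_zero]
          have hne : ¬ (artinSchreierRoot a + 1 = artinSchreierRoot a) := by simp
          rw [hτ, map_add, map_one, hσ, this, if_pos rfl, if_neg hne, hh] }
  isOpen_ker := by
    refine Subgroup.isOpen_mono (H₁ := MulAction.stabilizer (AbsGal k) (artinSchreierRoot a))
      (fun σ hσ => ?_) (stabilizer_isOpen_of_isIntegral (artinSchreierRoot a))
    have hσ' : σ (artinSchreierRoot a) = artinSchreierRoot a := hσ
    simp [MonoidHom.mem_ker, hσ']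

/-- Serre's symbol `[a, b) = (φ_a, b) ∈ Br k`. -/
def serreSymbol (a : k) (b : kˣ) : Br k :=
  (artinSchreierChar a).cup b

end ArtinSchreier

/-! ## The local invariant

`K` is a field with a discrete valuation `v`; the definitions are used for `K` complete with
finite residue field. -/

section Invariant

variable {K : Type*} [Field K] {Γ : Type*} [LinearOrderedCommGroupWithZero Γ]
  (v : Valuation K Γ)

/-- The integral closure of the valuation ring of `K` in the separable closure of `K`. -/
abbrev integersSep : Subalgebra v.valuationSubring (SepCl K) :=
  integralClosure v.valuationSubring (SepCl K)

/-- The cyclic extension of `K` cut out by `χ`. -/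
def GalChar.field (χ : GalChar K) : IntermediateField K (SepCl K) :=
  IntermediateField.fixedField χ.toHom.ker

/-- `ϖ` is a uniformizer of `K`. -/
def IsUniformizerOf (ϖ : Kˣ) : Prop :=
  ∃ p : v.valuationSubring, Irreducible p ∧ (p : K) = ϖ

/-- The cyclic extension cut out by `χ` is unramified: every uniformizer of `K` divides all
non-units of its ring of integers, that is, the ramification index is one. (As the residue field
of `K` is finite, the residue extension is automatically separable.) -/
def GalChar.IsUnramified (χ : GalChar K) : Prop :=
  ∀ p : v.valuationSubring, Irreducible p →
    ∀ x : integersSep v, (x : SepCl K) ∈ χ.field → ¬ IsUnit x →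
      algebraMap v.valuationSubring (integersSep v) p ∣ x

/-- `F` induces the arithmetic Frobenius on the cyclic extension cut out by `χ`: for all integers
`x` of this extension, `F x - x ^ q` lies in the maximal ideal (the set of non-units), where `q`
is the cardinality of the residue field of `K`. -/
def GalChar.IsFrobenius (χ : GalChar K) (F : AbsGal K) : Prop :=
  ∀ x : integersSep v, (x : SepCl K) ∈ χ.field →
    ∃ z : integersSep v, ¬ IsUnit z ∧
      (z : SepCl K) =
        F x - (x : SepCl K) ^
          Nat.card (IsLocalRing.ResidueField v.valuationSubring)

/-- `inv x = c`: the class `x` is `(χ, ϖ)` for a uniformizer `ϖ` and an unramified character `χ`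
with `χ(Frob) = c`. This describes the composite isomorphism
`Br K ≅ H²(Gal(Kⁿʳ/K), (Kⁿʳ)ˣ) → H²(Gal(Kⁿʳ/K), ℤ) ≅ Hom(Gal(Kⁿʳ/K), ℚ/ℤ) ≅ ℚ/ℤ`, in which the
first arrow is the inverse of inflation, the second is induced by the valuation, the third is
`δ⁻¹` and the last is evaluation at the Frobenius. -/
def HasInvariant (x : Br K) (c : QmodZ) : Prop :=
  ∃ (χ : GalChar K) (ϖ : Kˣ) (F : AbsGal K), χ.IsUnramified v ∧ IsUniformizerOf v ϖ ∧
    χ.IsFrobenius v F ∧ (χ.toHom F).toAdd = c ∧ x = χ.cup ϖ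

open Classical in
/-- The local invariant `inv : Br K → ℚ/ℤ`. -/
def localInvariant (x : Br K) : QmodZ :=
  if h : ∃ c, HasInvariant v x c then h.choose else 0

open Classical in
/-- The local symbol `[a, b)_v = 2 · inv [a, b) ∈ ℤ/2ℤ`. The invariant of `[a, b)` lies in
`(1/2)ℤ/ℤ = {0, 1/2}`, which is identified with `ℤ/2ℤ` by multiplication by two. -/
def localSymbol [CharP K 2] (a : K) (b : Kˣ) : ZMod 2 :=
  if localInvariant v (serreSymbol a b) = 0 then 0 else 1

end Invariant

/-! ## The conic -/

/-- The `F`-rational points of the conic `x₀² + x₀x₁ + y x₁² = t x₂²` in the projective plane.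
(The equation is homogeneous, hence independent of the representative.) -/
def conicPoints {F : Type*} [Field F] (t y : F) : Set (Projectivization F (Fin 3 → F)) :=
  {P | P.rep 0 ^ 2 + P.rep 0 * P.rep 1 + y * P.rep 1 ^ 2 = t * P.rep 2 ^ 2}

/-- The Artin–Schreier algebra `F[a]/(a² - a - y)`, a quadratic étale algebra over `F`. -/
abbrev ArtinSchreierAlg {F : Type*} [Field F] (y : F) : Type _ :=
  AdjoinRoot (X ^ 2 - X - C y : F[X])

/-! ## The places of `𝔽₂(t)` and the completions -/

/-- The rational function field `𝔽₂(t)`. -/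
abbrev F2t : Type := RatFunc (ZMod 2)

/-- The places of `𝔽₂(t)`: the maximal ideals of `𝔽₂[t]` (equivalently, the monic irreducible
polynomials) and the place at infinity. -/
inductive Place : Type
  | finite (P : IsDedekindDomain.HeightOneSpectrum (ZMod 2)[X])
  | infinity

namespace Place

open Classical in
/-- The normalized (multiplicative) valuation of a place. -/
def valuation : Place → Valuation F2t ℤᵐ⁰
  | finite P => P.valuation F2t
  | infinity => RatFunc.inftyValuation (ZMod 2)

/-- The completion of `𝔽₂(t)` at a place. -/
def completion (ω : Place) : Type :=
  ω.valuation.Completion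

instance (ω : Place) : Field ω.completion :=
  inferInstanceAs (Field ω.valuation.Completion)

/-- The embedding of `𝔽₂(t)` into its completion. -/
def embed (ω : Place) : F2t →+* ω.completion :=
  ((UniformSpace.Completion.coeRingHom (α := WithVal ω.valuation)).comp
    (WithVal.equiv ω.valuation).symm.toRingHom : F2t →+* ω.valuation.Completion)

instance (ω : Place) : CharP ω.completion 2 :=
  have : CharP F2t 2 :=
    charP_of_injective_algebraMap (algebraMap (ZMod 2) F2t).injective 2
  (RingHom.charP_iff ω.embed ω.embed.injective 2).1 this

/-- The valuation of the completion. -/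
def complVal (ω : Place) : Valuation ω.completion ℤᵐ⁰ :=
  (Valued.v : Valuation ω.valuation.Completion ℤᵐ⁰)

/-- The element `t` of the completion. -/
def t (ω : Place) : ω.completionˣ :=
  Units.map ω.embed.toMonoidHom (Units.mk0 (RatFunc.X : F2t) RatFunc.X_ne_zero)

end Place

end

noncomputable section

/-! ### Galois cohomology: the cup product `b ∪ δχ` and cochains that trivialize it -/

section Brauer

variable {k : Type*} [Field k]

/-! All three conditions say that `t` is a value of the binary form `a² + ab + yb²`. This is the
norm form of the Artin–Schreier algebra in the basis given by `1` and the root. A point of the conic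
with `x₂ ≠ 0` gives such a value after division by `x₂`; a point with `x₂ = 0` makes the form
isotropic, so that `X² - X - y` has a root and the form, a product of two independent linear forms,
represents everything. Finally `serreSymbol_eq_one_iff` is the norm criterion for cyclic classes: by
Hilbert 90 a cochain trivializing `[y, t)` may be taken with values in `k(α)` and trivial on the
kernel of the character, and its relation at `(s, s)`, for `s` outside the kernel, says that `t` is
a norm.

It remains to see that the invariant of a symbol vanishes only if the class does
(`ExtVal.localSymbol_eq_zero_iff`). The invariant is read off a presentation `(χ, ϖ)` with `χ`
unramified, and is zero by default, so three facts are needed. A nontrivial symbol has such a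
presentation (`ExtVal.exists_hasInvariant_serreSymbol`): poles of even order are lowered by adding
`z² - z`, and poles of odd order are treated with `[c, c) = 1`. An unramified character trivial at
the Frobenius is trivial (`ExtVal.eq_one_of_isFrobenius`), by successive approximation and
completeness. If `(χ, ϖ) = 1` with `χ` unramified, then `χ = 1` (`ExtVal.eq_one_of_cup_eq_one`), by
comparing valuations. Uniqueness of the invariant is never needed.

The local arguments use only a Galois invariant real valuation on the separable closure (`ExtVal`),
a uniformizer and a finite residue field. For the completions of `𝔽₂(t)` the valuation is the
spectral norm. -/

instance : CommGroup (Br k) := QuotientGroup.Quotient.commGroup _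

instance : IsGalois k (SepCl k) := IsSepClosure.isGalois

theorem GalChar.lift_nonneg (χ : GalChar k) (σ : AbsGal k) : 0 ≤ χ.lift σ :=
  (AddCircle.equivIco (1 : ℚ) 0 (χ.toHom σ).toAdd).2.1

theorem GalChar.lift_lt_one (χ : GalChar k) (σ : AbsGal k) : χ.lift σ < 1 := by
  exact (AddCircle.equivIco (1 : ℚ) 0 (χ.toHom σ).toAdd).2.2.trans_eq (zero_add 1)

theorem GalChar.lift_eq_zero_iff (χ : GalChar k) (σ : AbsGal k) :
    χ.lift σ = 0 ↔ χ.toHom σ = 1 := by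
  constructor
  · intro h
    have := χ.coe_lift σ
    rw [h, AddCircle.coe_zero] at this
    exact (toAdd_eq_zero.1 this.symm)
  · intro h
    have h1 := χ.coe_lift σ
    rw [h, toAdd_one, AddCircle.coe_eq_zero_iff] at h1
    obtain ⟨n, hn⟩ := h1
    have h0 := χ.lift_nonneg σ
    have h2 := χ.lift_lt_one σ
    rw [← hn] at h0 h2 ⊢
    simp only [zsmul_eq_mul, mul_one] at *
    have h0 : 0 ≤ n := by exact_mod_cast h0
    have h2 : n < 1 := by exact_mod_cast h2
    have : n = 0 := by omega
    simp [this]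

/-- The lift depends only on the class modulo the kernel, so the cocycle is inflated from the finite
cyclic quotient. This is what makes a trivializing cochain an honest cocycle on the kernel. -/
theorem GalChar.delta_eq_zero_of_left (χ : GalChar k) {σ : AbsGal k} (hσ : χ.toHom σ = 1)
    (τ : AbsGal k) : χ.delta σ τ = 0 := by
  have h := χ.coe_delta σ τ
  have h1 : χ.lift (σ * τ) = χ.lift τ := by simp [GalChar.lift, hσ]
  rw [h1, (χ.lift_eq_zero_iff σ).2 hσ] at h
  simpa using h

theorem GalChar.delta_eq_zero_of_right (χ : GalChar k) (σ : AbsGal k) {τ : AbsGal k}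
    (hτ : χ.toHom τ = 1) : χ.delta σ τ = 0 := by
  have h := χ.coe_delta σ τ
  have h1 : χ.lift (σ * τ) = χ.lift σ := by simp [GalChar.lift, hτ]
  rw [h1, (χ.lift_eq_zero_iff τ).2 hτ] at h
  simpa using h

/-- The image of `b ∈ kˣ` in the units of the separable closure. -/
abbrev baseUnit (b : kˣ) : (SepCl k)ˣ := Units.map (algebraMap k (SepCl k)) b

theorem smul_baseUnit (g : AbsGal k) (b : kˣ) : g • baseUnit b = baseUnit b := by
  ext1
  simp

theorem GalChar.cup_eq_one_iff (χ : GalChar k) (b : kˣ) :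
    χ.cup b = 1 ↔ ∃ x : AbsGal k → (SepCl k)ˣ, IsLocallyConstant x ∧
      ∀ g h : AbsGal k, g • x h / x (g * h) * x g = baseUnit b ^ χ.delta g h := by
  rw [GalChar.cup, QuotientGroup.eq_one_iff, Subgroup.mem_subgroupOf]
  exact Iff.rfl

theorem GalChar.cup_mul (χ : GalChar k) (b c : kˣ) : χ.cup (b * c) = χ.cup b * χ.cup c := by
  rw [GalChar.cup, GalChar.cup, GalChar.cup, ← QuotientGroup.mk_mul]
  congr 1
  ext1
  funext p
  simp only [Subgroup.coe_mul, Pi.mul_apply]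
  rw [← mul_zpow, ← map_mul]

theorem GalChar.isLocallyConstant_lift (χ : GalChar k) : IsLocallyConstant χ.lift :=
  χ.isLocallyConstant.comp
    (fun c : Multiplicative QmodZ => (AddCircle.equivIco (1 : ℚ) 0 c.toAdd : ℚ))

/-- The cup product is additive in the character. -/
theorem GalChar.cup_eq_mul_of_forall (χ χ₁ χ₂ : GalChar k)
    (h : ∀ σ, χ.toHom σ = χ₁.toHom σ * χ₂.toHom σ) (b : kˣ) :
    χ.cup b = χ₁.cup b * χ₂.cup b := by
  rw [eq_comm, GalChar.cup, GalChar.cup, GalChar.cup, ← QuotientGroup.mk_mul, QuotientGroup.eq,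
    Subgroup.mem_subgroupOf]
  -- The lifts are additive only up to an integer; `b` to the power of that integer is the cochain
  -- whose coboundary compares the two sides.
  have hn : ∀ σ, ((⌊χ.lift σ - χ₁.lift σ - χ₂.lift σ⌋ : ℤ) : ℚ) =
      χ.lift σ - χ₁.lift σ - χ₂.lift σ := by
    intro σ
    have h0 : ((χ.lift σ - χ₁.lift σ - χ₂.lift σ : ℚ) : QmodZ) = 0 := by
      rw [AddCircle.coe_sub, AddCircle.coe_sub, χ.coe_lift, χ₁.coe_lift, χ₂.coe_lift, h, toAdd_mul]
      abel
    obtain ⟨n, hn⟩ := (AddCircle.coe_eq_zero_iff (1 : ℚ)).1 h0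
    rw [← hn]
    simp
  refine ⟨fun σ => baseUnit b ^ ⌊χ.lift σ - χ₁.lift σ - χ₂.lift σ⌋,
    ((χ.isLocallyConstant_lift.sub χ₁.isLocallyConstant_lift).sub
      χ₂.isLocallyConstant_lift).comp (fun r => baseUnit b ^ ⌊r⌋), fun σ τ => ?_⟩
  change _ = (baseUnit b ^ χ₁.delta σ τ * baseUnit b ^ χ₂.delta σ τ)⁻¹ *
    baseUnit b ^ χ.delta σ τ
  beta_reduce
  rw [smul_zpow', smul_baseUnit, div_eq_mul_inv, ← zpow_sub, ← zpow_add, ← zpow_add, ← zpow_neg,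
    ← zpow_add]
  congr 1
  have : (((⌊χ.lift τ - χ₁.lift τ - χ₂.lift τ⌋ -
      ⌊χ.lift (σ * τ) - χ₁.lift (σ * τ) - χ₂.lift (σ * τ)⌋ +
      ⌊χ.lift σ - χ₁.lift σ - χ₂.lift σ⌋ : ℤ)) : ℚ) =
      ((-(χ₁.delta σ τ + χ₂.delta σ τ) + χ.delta σ τ : ℤ) : ℚ) := by
    push_cast
    rw [hn, hn, hn, χ.coe_delta, χ₁.coe_delta, χ₂.coe_delta]
    ring
  exact_mod_cast this

theorem GalChar.cup_eq_one_of_trivial (χ : GalChar k) (h : ∀ σ, χ.toHom σ = 1) (b : kˣ) :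
    χ.cup b = 1 := by
  rw [χ.cup_eq_one_iff]
  exact ⟨1, IsLocallyConstant.const 1, fun σ τ => by simp [χ.delta_eq_zero_of_left (h σ)]⟩

/-- Hilbert's Theorem 90 for locally constant cocycles of a subgroup of the absolute Galois
group. -/
theorem exists_unit_of_isLocallyConstant_cocycle (N : Subgroup (AbsGal k))
    (x : AbsGal k → (SepCl k)ˣ) (hx : IsLocallyConstant x)
    (hN : ∀ g ∈ N, ∀ h ∈ N, x (g * h) = x g * g • x h) :
    ∃ u : (SepCl k)ˣ, ∀ g ∈ N, g • u * x g = u := by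
  classical
  have hx1 : x 1 = 1 := by simpa using hN 1 N.one_mem 1 N.one_mem
  have hnhds : {σ | x σ = 1} ∈ nhds (1 : AbsGal k) :=
    (hx.isOpen_fiber 1).mem_nhds hx1
  rw [krullTopology_mem_nhds_one_iff] at hnhds
  obtain ⟨E, hE, hsub⟩ := hnhds
  -- On `N` the cocycle depends only on the restriction to the finite extension `E`, so the
  -- classical sum over a finite Galois group becomes a sum over the set `T` of embeddings of `E`
  -- induced by `N`.
  let r : AbsGal k → (E →ₐ[k] SepCl k) := fun σ => (σ : SepCl k →ₐ[k] SepCl k).comp E.val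
  have hrx : ∀ σ ∈ N, ∀ τ ∈ N, r σ = r τ → x σ = x τ := by
    intro σ hσ τ hτ h
    have hmem : σ⁻¹ * τ ∈ E.fixingSubgroup := by
      rw [IntermediateField.mem_fixingSubgroup_iff]
      intro z hz
      have := DFunLike.congr_fun h ⟨z, hz⟩
      change σ z = τ z at this
      rw [AlgEquiv.mul_apply, ← this]
      exact AlgEquiv.symm_apply_apply σ z
    have h1 : x (σ⁻¹ * τ) = 1 := hsub hmem
    have h2 := hN σ hσ (σ⁻¹ * τ) (N.mul_mem (N.inv_mem hσ) hτ)
    rw [h1, smul_one, mul_one, mul_inv_cancel_left] at h2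
    exact h2.symm
  let T : Finset (E →ₐ[k] SepCl k) := (Set.toFinite (r '' N)).toFinset
  have hT : ∀ f, f ∈ T ↔ ∃ σ ∈ N, r σ = f := fun f => by simp [T]
  let s : (E →ₐ[k] SepCl k) → AbsGal k := fun f =>
    if h : ∃ σ ∈ N, r σ = f then h.choose else 1
  have hs : ∀ f ∈ T, s f ∈ N ∧ r (s f) = f := by
    intro f hf
    have h := (hT f).1 hf
    simp only [s, dif_pos h]
    exact h.choose_spec
  have hxs : ∀ σ ∈ N, x (s (r σ)) = x σ := fun σ hσ => by
    obtain ⟨h1, h2⟩ := hs (r σ) ((hT _).2 ⟨σ, hσ, rfl⟩)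
    exact hrx _ h1 _ hσ h2
  -- Dedekind's independence of characters, applied to the embeddings in `T`.
  obtain ⟨c, hc⟩ : ∃ c : E, ∑ f ∈ T, (x (s f) : SepCl k) * f c ≠ 0 := by
    by_contra! hcon
    have hli := (linearIndependent_monoidHom E (SepCl k)).comp
      (fun f : E →ₐ[k] SepCl k => (f : E →* SepCl k)) (fun f g h => by
        ext z
        exact DFunLike.congr_fun h z)
    rw [linearIndependent_iff'] at hli
    have h0 := hli T (fun f => (x (s f) : SepCl k)) (by
      funext z
      simpa [Finset.sum_apply] using hcon z) (r 1) ((hT _).2 ⟨1, N.one_mem, rfl⟩)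
    exact (x (s (r 1))).ne_zero h0
  refine ⟨Units.mk0 _ hc, fun g hg => ?_⟩
  ext1
  change g (∑ f ∈ T, (x (s f) : SepCl k) * f c) * x g = ∑ f ∈ T, (x (s f) : SepCl k) * f c
  rw [map_sum, Finset.sum_mul]
  refine Finset.sum_bij (fun f _ => (g : SepCl k →ₐ[k] SepCl k).comp f) ?_ ?_ ?_ ?_
  · intro f hf
    obtain ⟨h1, h2⟩ := hs f hf
    refine (hT _).2 ⟨g * s f, N.mul_mem hg h1, ?_⟩
    conv_rhs => rw [← h2]
    rfl
  · intro f _ f' _ h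
    ext z
    exact g.injective (DFunLike.congr_fun h z)
  · intro f hf
    obtain ⟨h1, h2⟩ := hs f hf
    refine ⟨r (g⁻¹ * s f), (hT _).2 ⟨_, N.mul_mem (N.inv_mem hg) h1, rfl⟩, ?_⟩
    conv_rhs => rw [← h2]
    ext z
    exact AlgEquiv.apply_symm_apply g _
  · intro f hf
    obtain ⟨h1, h2⟩ := hs f hf
    have h3 : (g : SepCl k →ₐ[k] SepCl k).comp f = r (g * s f) := by
      conv_lhs => rw [← h2]
      rfl
    have h4 : r (g * s f) c = g (f c) := by rw [← h3]; rfl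
    have h5 : ((g • x (s f) : (SepCl k)ˣ) : SepCl k) = g (x (s f)) := rfl
    rw [h3, hxs _ (N.mul_mem hg h1), hN g hg _ h1, map_mul, Units.val_mul, h5, h4]
    ring

/-- A trivialization of the cup product may be chosen to be inflated from the cyclic extension
cut out by the character. -/
theorem GalChar.exists_cochain_of_cup_eq_one (χ : GalChar k) (b : kˣ) (h : χ.cup b = 1) :
    ∃ x : AbsGal k → (SepCl k)ˣ,
      (∀ g h : AbsGal k, g • x h * x g = baseUnit b ^ χ.delta g h * x (g * h)) ∧
      (∀ σ, χ.toHom σ = 1 → x σ = 1) ∧ ∀ σ, (x σ : SepCl k) ∈ χ.field := by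
  obtain ⟨x, hx, hxb⟩ := (χ.cup_eq_one_iff b).1 h
  have hxb' : ∀ g h : AbsGal k, g • x h * x g = baseUnit b ^ χ.delta g h * x (g * h) := by
    intro g h
    rw [← hxb, mul_right_comm, div_mul_cancel]
  -- Multiplying `x` by the coboundary of `u` leaves the relation unchanged and makes the cochain
  -- trivial on the kernel.
  obtain ⟨u, hu⟩ := exists_unit_of_isLocallyConstant_cocycle χ.toHom.ker x hx (by
    intro g hg h hh
    have := hxb' g h
    rw [χ.delta_eq_zero_of_left hg, zpow_zero, one_mul] at this
    rw [← this, mul_comm])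
  have hmain : ∀ g h : AbsGal k, g • (h • u / u * x h) * (g • u / u * x g) =
      baseUnit b ^ χ.delta g h * ((g * h) • u / u * x (g * h)) := by
    intro g h
    have h1 := hxb' g h
    rw [smul_mul', smul_div', mul_smul]
    calc _ = (g • x h * x g) * (g • h • u / u * (g • u / g • u)) := by
          simp only [div_eq_mul_inv]
          simp only [mul_assoc, mul_comm, mul_left_comm]
      _ = _ := by
          rw [h1, div_self', mul_one]
          simp only [div_eq_mul_inv, mul_assoc, mul_comm, mul_left_comm]
  have htriv : ∀ σ, χ.toHom σ = 1 → σ • u / u * x σ = 1 := fun σ hσ => by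
    rw [div_mul_eq_mul_div, hu σ hσ, div_self']
  refine ⟨fun σ => σ • u / u * x σ, hmain, htriv, fun σ => ?_⟩
  rw [GalChar.field, IntermediateField.mem_fixedField_iff]
  intro τ hτ
  have hτ' : χ.toHom τ = 1 := hτ
  have h1 := hmain τ σ
  rw [χ.delta_eq_zero_of_left hτ', zpow_zero, one_mul, htriv τ hτ', mul_one] at h1
  -- The kernel is normal: evaluating the cochain at `τσ = σ(σ⁻¹τσ)` in both ways gives `τ • x σ = x
  -- σ`.
  have hτ2 : χ.toHom (σ⁻¹ * τ * σ) = 1 := by simp [hτ']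
  have h2 := hmain σ (σ⁻¹ * τ * σ)
  rw [χ.delta_eq_zero_of_right σ hτ2, zpow_zero, one_mul, htriv _ hτ2, smul_one, one_mul] at h2
  have h3 : σ * (σ⁻¹ * τ * σ) = τ * σ := by group
  rw [h3, ← h1] at h2
  exact (congrArg Units.val h2).symm

/-- Infinite Galois correspondence: the open kernel is closed, hence is the fixing subgroup of its
own fixed field. -/
theorem GalChar.eq_one_of_field_le_bot (χ : GalChar k) (h : χ.field ≤ ⊥) (σ : AbsGal k) :
    χ.toHom σ = 1 := by
  have h1 := InfiniteGalois.fixingSubgroup_fixedField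
    (⟨χ.toHom.ker, χ.toHom.ker.isClosed_of_isOpen χ.isOpen_ker⟩ : ClosedSubgroup (AbsGal k))
  change χ.field.fixingSubgroup = χ.toHom.ker at h1
  have : σ ∈ χ.field.fixingSubgroup := by
    rw [IntermediateField.mem_fixingSubgroup_iff]
    intro z hz
    obtain ⟨a, rfl⟩ := IntermediateField.mem_bot.1 (h hz)
    exact σ.commutes a
  rw [h1] at this
  exact this

end Brauer

/-! ### Artin–Schreier symbols: the norm criterion and bilinearity -/

section ArtinSchreier

variable {k : Type*} [Field k] [CharP k 2]

instance : CharP (SepCl k) 2 :=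
  charP_of_injective_algebraMap (algebraMap k (SepCl k)).injective 2

theorem artinSchreierChar_eq_one_iff (a : k) (σ : AbsGal k) :
    (artinSchreierChar a).toHom σ = 1 ↔ σ (artinSchreierRoot a) = artinSchreierRoot a := by
  classical
  change (if σ (artinSchreierRoot a) = artinSchreierRoot a then (1 : Multiplicative QmodZ)
        else Multiplicative.ofAdd (((1 / 2 : ℚ) : ℚ) : QmodZ)) = 1 ↔ _
  split_ifs with h
  · simp [h]
  · simp only [h, iff_false]
    rw [ofAdd_eq_one, AddCircle.coe_eq_zero_iff]
    rintro ⟨n, hn⟩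
    have h1 : (2 * n : ℚ) = 1 := by
      simp at hn
      rw [hn]
      norm_num
    have h2 : 2 * n = 1 := by exact_mod_cast h1
    omega

theorem artinSchreierChar_of_ne_one (a : k) {σ : AbsGal k}
    (h : (artinSchreierChar a).toHom σ ≠ 1) :
    (artinSchreierChar a).toHom σ = Multiplicative.ofAdd (((1 / 2 : ℚ) : ℚ) : QmodZ) := by
  classical
  exact if_neg (fun h' => h ((artinSchreierChar_eq_one_iff a σ).2 h'))

theorem artinSchreierRoot_apply_of_ne_one (a : k) {σ : AbsGal k}
    (h : (artinSchreierChar a).toHom σ ≠ 1) :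
    σ (artinSchreierRoot a) = artinSchreierRoot a + 1 :=
  (artinSchreierRoot_apply a σ).resolve_left
    (fun h' => h ((artinSchreierChar_eq_one_iff a σ).2 h'))

theorem artinSchreierChar_lift_of_ne_one (a : k) {σ : AbsGal k}
    (h : (artinSchreierChar a).toHom σ ≠ 1) : (artinSchreierChar a).lift σ = 1 / 2 := by
  rw [GalChar.lift, artinSchreierChar_of_ne_one a h, toAdd_ofAdd, AddCircle.coe_equivIco_mk_apply]
  norm_num

/-- The two lifts are `1/2` and the lift of the product is `0`; the carry `1/2 + 1/2 = 1` is where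
`b` itself enters the cocycle. -/
theorem artinSchreierChar_delta_of_ne_one (a : k) {σ τ : AbsGal k}
    (hσ : (artinSchreierChar a).toHom σ ≠ 1) (hτ : (artinSchreierChar a).toHom τ ≠ 1) :
    (artinSchreierChar a).toHom (σ * τ) = 1 ∧ (artinSchreierChar a).delta σ τ = 1 := by
  have h1 : (artinSchreierChar a).toHom (σ * τ) = 1 := by
    rw [artinSchreierChar_eq_one_iff, AlgEquiv.mul_apply, artinSchreierRoot_apply_of_ne_one a hτ,
      map_add, map_one, artinSchreierRoot_apply_of_ne_one a hσ, add_assoc,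
      CharTwo.add_self_eq_zero, add_zero]
  refine ⟨h1, ?_⟩
  have h2 := (artinSchreierChar a).coe_delta σ τ
  rw [artinSchreierChar_lift_of_ne_one a hσ, artinSchreierChar_lift_of_ne_one a hτ,
    ((artinSchreierChar a).lift_eq_zero_iff _).2 h1] at h2
  have h3 : ((artinSchreierChar a).delta σ τ : ℚ) = (1 : ℤ) := by rw [h2]; norm_num
  exact_mod_cast h3

/-- The extension cut out by `φ_a` is `k(α)`. -/
theorem exists_eq_add_mul_of_mem_field {a : k} {z : SepCl k}
    (hz : z ∈ (artinSchreierChar a).field) :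
    ∃ u v : k, z = algebraMap k _ u + algebraMap k _ v * artinSchreierRoot a := by
  rw [GalChar.field, IntermediateField.mem_fixedField_iff] at hz
  by_cases htriv : ∀ σ, (artinSchreierChar a).toHom σ = 1
  · obtain ⟨u, hu⟩ := (InfiniteGalois.mem_range_algebraMap_iff_fixed (k := k) z).2
      (fun σ => hz σ (htriv σ))
    exact ⟨u, 0, by simp [hu]⟩
  push Not at htriv
  obtain ⟨s, hs⟩ := htriv
  -- All elements outside the kernel act on the fixed field as `s` does. Since `s α = α + 1`, the
  -- coefficient `v` must be the trace `z + s z`, and then `u = z + vα`.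
  have key : ∀ σ, (artinSchreierChar a).toHom σ ≠ 1 → σ z = s z := by
    intro σ hσ
    have h1 : (artinSchreierChar a).toHom (s⁻¹ * σ) = 1 :=
      (artinSchreierChar_delta_of_ne_one a (by simpa using hs) hσ).1
    have h2 : s⁻¹ (σ z) = z := hz _ h1
    have h3 : s (s⁻¹ (σ z)) = σ z := AlgEquiv.apply_symm_apply s _
    rw [← h3, h2]
  have hss : s (s z) = z := by
    exact hz (s * s) (artinSchreierChar_delta_of_ne_one a hs hs).1
  obtain ⟨v, hv⟩ := (InfiniteGalois.mem_range_algebraMap_iff_fixed (k := k) (z + s z)).2 (by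
    intro σ
    by_cases hσ : (artinSchreierChar a).toHom σ = 1
    · have h2 : (artinSchreierChar a).toHom (s⁻¹ * σ * s) = 1 := by simp [hσ]
      have h3 : s ((s⁻¹ * σ * s) z) = s z := congrArg s (hz _ h2)
      have h4 : s ((s⁻¹ * σ * s) z) = σ (s z) := AlgEquiv.apply_symm_apply s _
      rw [map_add, hz σ hσ, ← h4, h3]
    · have h2 : (artinSchreierChar a).toHom (σ * s) = 1 :=
        (artinSchreierChar_delta_of_ne_one a hσ hs).1
      have h3 : σ (s z) = z := hz _ h2
      rw [map_add, key σ hσ, h3, add_comm])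
  obtain ⟨u, hu⟩ := (InfiniteGalois.mem_range_algebraMap_iff_fixed (k := k)
      (z + algebraMap k _ v * artinSchreierRoot a)).2 (by
    intro σ
    by_cases hσ : (artinSchreierChar a).toHom σ = 1
    · rw [map_add, map_mul, AlgEquiv.commutes, (artinSchreierChar_eq_one_iff a σ).1 hσ, hz σ hσ]
    · rw [map_add, map_mul, AlgEquiv.commutes, artinSchreierRoot_apply_of_ne_one a hσ, key σ hσ,
        hv]
      linear_combination (s z) * (CharTwo.two_eq_zero : (2 : SepCl k) = 0))
  refine ⟨u, v, ?_⟩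
  rw [hu]
  linear_combination -(algebraMap k _ v * artinSchreierRoot a) *
    (CharTwo.two_eq_zero : (2 : SepCl k) = 0)

theorem artinSchreierChar_eq_one_of_eq {a β : k} (h : β ^ 2 - β = a) (σ : AbsGal k) :
    (artinSchreierChar a).toHom σ = 1 := by
  rw [artinSchreierChar_eq_one_iff]
  have h2 : (2 : SepCl k) = 0 := CharTwo.two_eq_zero
  have hα := artinSchreierRoot_spec a
  have hβ := congrArg (algebraMap k (SepCl k)) h
  rw [map_sub, map_pow] at hβ
  have hm : (artinSchreierRoot a - algebraMap k _ β) *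
      (artinSchreierRoot a - (algebraMap k _ β + 1)) = 0 := by
    linear_combination hα - hβ + (algebraMap k _ β ^ 2
      - artinSchreierRoot a * algebraMap k _ β) * h2
  rcases mul_eq_zero.1 hm with h | h <;> rw [sub_eq_zero.1 h] <;> simp

/-- If `X² - X - a` has a root in `k`, then its norm form represents everything. -/
theorem exists_normForm_of_root {a β : k} (hβ : β ^ 2 - β = a) (b : k) :
    ∃ x y : k, x ^ 2 + x * y + a * y ^ 2 = b := by
  have h2 : (2 : k) = 0 := CharTwo.two_eq_zero
  -- The form factors as `(x + βy)(x + (β + 1)y)`; this pair makes the factors `b` and `1`.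
  refine ⟨b + β * (1 + b), 1 + b, ?_⟩
  rw [← hβ]
  linear_combination (b * β + b ^ 2 * β + (1 + b) ^ 2 * β ^ 2 + b ^ 2 * 1) * h2

/-- The conjugates `α` and `α + 1` have sum `1` and product `a` in characteristic two. -/
theorem artinSchreier_mul_conj (a x y : k) :
    (algebraMap k (SepCl k) x + algebraMap k _ y * artinSchreierRoot a) *
      (algebraMap k (SepCl k) x + algebraMap k _ y * (artinSchreierRoot a + 1)) =
      algebraMap k _ (x ^ 2 + x * y + a * y ^ 2) := by
  have h2 : (2 : SepCl k) = 0 := CharTwo.two_eq_zero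
  simp only [map_add, map_mul, map_pow, ← artinSchreierRoot_spec a]
  linear_combination (algebraMap k (SepCl k) x * algebraMap k _ y * artinSchreierRoot a +
    algebraMap k (SepCl k) y ^ 2 * artinSchreierRoot a) * h2

/-- The symbol `[a, b)` vanishes if and only if `b` is represented by the norm form of the
Artin–Schreier extension attached to `a`. -/
theorem serreSymbol_eq_one_iff (a : k) (b : kˣ) :
    serreSymbol a b = 1 ↔ ∃ x y : k, x ^ 2 + x * y + a * y ^ 2 = b := by
  constructor
  · intro h
    by_cases htriv : ∀ σ, (artinSchreierChar a).toHom σ = 1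
    · obtain ⟨β, hβ⟩ := (InfiniteGalois.mem_range_algebraMap_iff_fixed (k := k)
        (artinSchreierRoot a)).2 (fun σ => (artinSchreierChar_eq_one_iff a σ).1 (htriv σ))
      refine exists_normForm_of_root (β := β) ?_ _
      apply (algebraMap k (SepCl k)).injective
      rw [map_sub, map_pow, hβ, artinSchreierRoot_spec]
    · push Not at htriv
      obtain ⟨s, hs⟩ := htriv
      obtain ⟨x, hx, hx1, hxf⟩ := (artinSchreierChar a).exists_cochain_of_cup_eq_one b h
      obtain ⟨u, v, huv⟩ := exists_eq_add_mul_of_mem_field (hxf s)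
      refine ⟨u, v, (algebraMap k (SepCl k)).injective ?_⟩
      obtain ⟨h1, h2⟩ := artinSchreierChar_delta_of_ne_one a hs hs
      have h3 := hx s s
      rw [hx1 _ h1, h2, mul_one, zpow_one] at h3
      have h4 : s (x s) * x s = algebraMap k (SepCl k) b := congrArg Units.val h3
      rw [← artinSchreier_mul_conj, ← h4, huv, map_add, map_mul, AlgEquiv.commutes,
        -- The relation at `(s, s)` has become `s(x s) · x s = b`, a norm from `k(α)`.
        AlgEquiv.commutes, artinSchreierRoot_apply_of_ne_one a hs, mul_comm]
  · rintro ⟨x, y, hxy⟩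
    classical
    have hc := artinSchreier_mul_conj a x y
    rw [hxy] at hc
    have hz : algebraMap k (SepCl k) x + algebraMap k _ y * artinSchreierRoot a ≠ 0 := by
      intro h
      rw [h, zero_mul] at hc
      exact b.ne_zero ((map_eq_zero _).1 hc.symm)
    -- The trivializing cochain is `1` on the kernel and the element of norm `b` off it.
    refine ((artinSchreierChar a).cup_eq_one_iff b).2
      ⟨fun σ => if (artinSchreierChar a).toHom σ = 1 then 1 else Units.mk0 _ hz,
        (artinSchreierChar a).isLocallyConstant.comp
          (fun c => if c = 1 then 1 else Units.mk0 _ hz), fun g h => ?_⟩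
    by_cases hg : (artinSchreierChar a).toHom g = 1
    · rw [(artinSchreierChar a).delta_eq_zero_of_left hg]
      simp only [hg, map_mul, one_mul, if_true, mul_one, zpow_zero, div_eq_one]
      split_ifs
      · simp
      · ext1
        change g _ = _
        simp only [Units.val_mk0]
        rw [map_add, map_mul, AlgEquiv.commutes, AlgEquiv.commutes,
          (artinSchreierChar_eq_one_iff a g).1 hg]
    · by_cases hh : (artinSchreierChar a).toHom h = 1
      · rw [(artinSchreierChar a).delta_eq_zero_of_right g hh]
        simp [hg, hh]
      · obtain ⟨h1, h2⟩ := artinSchreierChar_delta_of_ne_one a hg hh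
        beta_reduce
        rw [h2, if_neg hh, if_neg hg, if_pos h1, div_one, zpow_one]
        ext1
        change g _ * _ = algebraMap k (SepCl k) b
        simp only [Units.val_mk0]
        rw [← hc, map_add, map_mul, AlgEquiv.commutes, AlgEquiv.commutes,
          artinSchreierRoot_apply_of_ne_one a hg, mul_comm]

theorem serreSymbol_mul (a : k) (b c : kˣ) :
    serreSymbol a (b * c) = serreSymbol a b * serreSymbol a c :=
  (artinSchreierChar a).cup_mul b c

/-- A sum of roots for `a` and `a'` is a root for `a + a'`. The chosen root may differ from it by
`1`, which does not affect `σγ - γ`. -/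
theorem serreSymbol_add (a a' : k) (b : kˣ) :
    serreSymbol (a + a') b = serreSymbol a b * serreSymbol a' b := by
  refine GalChar.cup_eq_mul_of_forall _ _ _ (fun σ => ?_) b
  have h2 : (2 : SepCl k) = 0 := CharTwo.two_eq_zero
  set α := artinSchreierRoot a with hα
  set β := artinSchreierRoot a' with hβ
  set γ := artinSchreierRoot (a + a') with hγ
  have hαβγ : γ = α + β ∨ γ = α + β + 1 := by
    have h : (γ - (α + β)) * (γ - (α + β + 1)) = 0 := by
      have e1 := artinSchreierRoot_spec a
      have e2 := artinSchreierRoot_spec a'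
      have e3 := artinSchreierRoot_spec (a + a')
      rw [map_add] at e3
      linear_combination e3 - e1 - e2 + (α ^ 2 + β ^ 2 + α * β - γ * (α + β)) * h2
    rcases mul_eq_zero.1 h with h | h
    · exact Or.inl (sub_eq_zero.1 h)
    · exact Or.inr (sub_eq_zero.1 h)
  have hγσ : σ γ - γ = (σ α - α) + (σ β - β) := by
    rcases hαβγ with h | h <;> rw [h] <;> simp only [map_add, map_one] <;> ring
  by_cases h1 : (artinSchreierChar a).toHom σ = 1
  · have e1 := (artinSchreierChar_eq_one_iff a σ).1 h1
    rw [← hα] at e1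
    rw [e1, sub_self, zero_add] at hγσ
    by_cases h3 : (artinSchreierChar a').toHom σ = 1
    · rw [h1, h3, one_mul, artinSchreierChar_eq_one_iff]
      have e2 := (artinSchreierChar_eq_one_iff a' σ).1 h3
      rw [← hβ] at e2
      rwa [e2, sub_self, sub_eq_zero] at hγσ
    · rw [h1, one_mul, artinSchreierChar_of_ne_one a' h3]
      apply artinSchreierChar_of_ne_one
      rw [ne_eq, artinSchreierChar_eq_one_iff]
      rw [artinSchreierChar_eq_one_iff] at h3
      rw [← sub_eq_zero] at h3 ⊢
      rwa [← hγ, hγσ]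
  · by_cases h3 : (artinSchreierChar a').toHom σ = 1
    · rw [h3, mul_one, artinSchreierChar_of_ne_one a h1]
      apply artinSchreierChar_of_ne_one
      have e2 := (artinSchreierChar_eq_one_iff a' σ).1 h3
      rw [← hβ] at e2
      rw [e2, sub_self, add_zero] at hγσ
      rw [ne_eq, artinSchreierChar_eq_one_iff]
      rw [artinSchreierChar_eq_one_iff] at h1
      rw [← sub_eq_zero] at h1 ⊢
      rwa [← hγ, hγσ]
    · have e1 := artinSchreierRoot_apply_of_ne_one a h1
      have e2 := artinSchreierRoot_apply_of_ne_one a' h3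
      rw [← hα] at e1
      rw [← hβ] at e2
      have h4 : (artinSchreierChar (a + a')).toHom σ = 1 := by
        rw [artinSchreierChar_eq_one_iff, ← hγ]
        rw [e1, e2] at hγσ
        linear_combination hγσ + h2
      rw [h4, artinSchreierChar_of_ne_one a h1, artinSchreierChar_of_ne_one a' h3, ← ofAdd_add,
        ← AddCircle.coe_add, add_halves, AddCircle.coe_period, ofAdd_zero]

theorem serreSymbol_sq (a : k) (c : kˣ) : serreSymbol a (c ^ 2) = 1 :=
  (serreSymbol_eq_one_iff a _).2 ⟨c, 0, by simp⟩

theorem serreSymbol_mul_sq (a : k) (b c : kˣ) :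
    serreSymbol a (b * c ^ 2) = serreSymbol a b := by
  rw [serreSymbol_mul, serreSymbol_sq, mul_one]

/-- `a` is the norm of its own Artin–Schreier root. Later this relation disposes of poles of odd
order. -/
theorem serreSymbol_self (a : kˣ) : serreSymbol (k := k) a a = 1 :=
  (serreSymbol_eq_one_iff (a : k) a).2 ⟨0, 1, by simp⟩

theorem serreSymbol_sq_sub_self (z : k) (b : kˣ) : serreSymbol (z ^ 2 - z) b = 1 :=
  (serreSymbol_eq_one_iff (z ^ 2 - z) b).2 (exists_normForm_of_root (k := k) rfl _)

end ArtinSchreier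

/-! ## Extension of the valuation to the separable closure -/

section ExtVal

open scoped NNReal

variable {K : Type*} [Field K] {Γ : Type*} [LinearOrderedCommGroupWithZero Γ]

/-- A Galois invariant extension to the separable closure of a rank one valuation, whose integers
are the integral elements, and for which `K` is closed in its separable closure. -/
structure ExtVal (v : Valuation K Γ) where
  /-- The extended valuation. -/
  w : Valuation (SepCl K) ℝ≥0
  map_galois : ∀ (σ : AbsGal K) (x : SepCl K), w (σ x) = w x
  le_one_iff : ∀ x : SepCl K, w x ≤ 1 ↔ IsIntegral v.valuationSubring x
  mem_range_of_approx : ∀ z : SepCl K,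
    (∀ ε : ℝ≥0, 0 < ε → ∃ a : K, w (z - algebraMap K (SepCl K) a) < ε) →
      z ∈ Set.range (algebraMap K (SepCl K))

namespace ExtVal

variable {v : Valuation K Γ} (W : ExtVal v)

/-- The restriction of the extended valuation to `K`. -/
def base : Valuation K ℝ≥0 := W.w.comap (algebraMap K (SepCl K))

theorem w_algebraMap (a : K) : W.w (algebraMap K (SepCl K) a) = W.base a := rfl

/-- A valuation ring is integrally closed, so `base` has the same ring of integers as `v` and can
replace it. -/
theorem base_le_one_iff (a : K) : W.base a ≤ 1 ↔ a ∈ v.valuationSubring := by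
  rw [← w_algebraMap, W.le_one_iff,
    isIntegral_algebraMap_iff (algebraMap K (SepCl K)).injective,
    IsIntegrallyClosed.isIntegral_iff]
  exact ⟨fun ⟨y, hy⟩ => hy ▸ y.2, fun h => ⟨⟨a, h⟩, rfl⟩⟩

theorem isUnit_iff (x : integersSep v) : IsUnit x ↔ W.w (x : SepCl K) = 1 := by
  constructor
  · rintro ⟨u, rfl⟩
    have h1 : W.w ((u : integersSep v) : SepCl K) ≤ 1 := (W.le_one_iff _).2 (u : integersSep v).2
    have h2 : W.w (((u⁻¹ : (integersSep v)ˣ) : integersSep v) : SepCl K) ≤ 1 :=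
      (W.le_one_iff _).2 ((u⁻¹ : (integersSep v)ˣ) : integersSep v).2
    have h3 : ((u : integersSep v) : SepCl K) *
        (((u⁻¹ : (integersSep v)ˣ) : integersSep v) : SepCl K) = 1 := by
      rw [← MulMemClass.coe_mul, Units.mul_inv, OneMemClass.coe_one]
    have h4 := congrArg W.w h3
    rw [map_mul, map_one] at h4
    refine le_antisymm h1 ?_
    rw [← h4]
    exact mul_le_of_le_one_right' h2
  · intro h
    have hx : (x : SepCl K) ≠ 0 := by
      intro h0
      rw [h0, map_zero] at h
      exact zero_ne_one h
    have h1 : W.w (x : SepCl K)⁻¹ ≤ 1 := by rw [map_inv₀, h, inv_one]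
    refine IsUnit.of_mul_eq_one ⟨(x : SepCl K)⁻¹, (W.le_one_iff _).1 h1⟩ ?_
    ext1
    exact mul_inv_cancel₀ hx

theorem not_isUnit_iff (x : integersSep v) : ¬ IsUnit x ↔ W.w (x : SepCl K) < 1 := by
  rw [W.isUnit_iff, lt_iff_le_and_ne]
  exact ⟨fun h => ⟨(W.le_one_iff _).2 x.2, h⟩, fun h => h.2⟩

theorem isUnit_base_iff (x : v.valuationSubring) : IsUnit x ↔ W.base (x : K) = 1 := by
  constructor
  · rintro ⟨u, rfl⟩
    have h1 := (W.base_le_one_iff _).2 (u : v.valuationSubring).2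
    have h2 := (W.base_le_one_iff _).2 ((u⁻¹ : (v.valuationSubring)ˣ) : v.valuationSubring).2
    have h3 : ((u : v.valuationSubring) : K) *
        (((u⁻¹ : (v.valuationSubring)ˣ) : v.valuationSubring) : K) = 1 := by
      rw [← MulMemClass.coe_mul, Units.mul_inv, OneMemClass.coe_one]
    have h4 := congrArg W.base h3
    rw [map_mul, map_one] at h4
    refine le_antisymm h1 ?_
    rw [← h4]
    exact mul_le_of_le_one_right' h2
  · intro h
    have hx : (x : K) ≠ 0 := by
      intro h0
      rw [h0, map_zero] at h
      exact zero_ne_one h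
    have h1 : W.base (x : K)⁻¹ ≤ 1 := by rw [map_inv₀, h, inv_one]
    refine IsUnit.of_mul_eq_one ⟨(x : K)⁻¹, (W.base_le_one_iff _).1 h1⟩ ?_
    ext1
    exact mul_inv_cancel₀ hx

theorem residue_eq_zero_iff (x : v.valuationSubring) :
    IsLocalRing.residue v.valuationSubring x = 0 ↔ W.base (x : K) < 1 := by
  rw [IsLocalRing.residue_eq_zero_iff, IsLocalRing.mem_maximalIdeal, mem_nonunits_iff,
    W.isUnit_base_iff, lt_iff_le_and_ne]
  exact ⟨fun h => ⟨(W.base_le_one_iff _).2 x.2, h⟩, fun h => h.2⟩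

/-! ### Uniformizers -/

theorem base_irreducible_pos {p : v.valuationSubring} (hp : Irreducible p) :
    0 < W.base (p : K) := by
  rw [Valuation.pos_iff]
  exact fun h => hp.ne_zero (Subtype.ext h)

theorem base_irreducible_lt_one {p : v.valuationSubring} (hp : Irreducible p) :
    W.base (p : K) < 1 :=
  lt_of_le_of_ne ((W.base_le_one_iff _).2 p.2) (fun h => hp.not_isUnit ((W.isUnit_base_iff p).2 h))

/-- Divisibility is total in a valuation ring, so an irreducible element divides every non-unit; no
value lies strictly between that of `p` and `1`. -/
theorem base_le_of_lt_one {p : v.valuationSubring} (hp : Irreducible p) {a : K}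
    (ha : W.base a < 1) : W.base a ≤ W.base (p : K) := by
  set x : v.valuationSubring := ⟨a, (W.base_le_one_iff a).1 ha.le⟩ with hx
  have hxu : ¬ IsUnit x := fun h => ha.ne ((W.isUnit_base_iff x).1 h)
  have hdvd : p ∣ x := by
    rcases ValuationRing.dvd_total p x with h | ⟨c, hc⟩
    · exact h
    · obtain ⟨u, hu⟩ := (hp.isUnit_or_isUnit hc).resolve_left hxu
      exact ⟨(u⁻¹ : (v.valuationSubring)ˣ), by rw [hc, ← hu, mul_assoc, Units.mul_inv, mul_one]⟩
  obtain ⟨c, hc⟩ := hdvd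
  have : a = p * c := congrArg Subtype.val hc
  rw [this, map_mul]
  exact mul_le_of_le_one_right' ((W.base_le_one_iff _).2 c.2)

/-- The interval above the value of `p` and up to `1` is a fundamental domain for scaling by `p`. -/
theorem exists_zpow_mul {p : v.valuationSubring} (hp : Irreducible p) {x : SepCl K} (hx : x ≠ 0) :
    ∃ n : ℤ, W.w (algebraMap K _ (p : K) ^ n * x) ≤ 1 ∧
      W.base (p : K) < W.w (algebraMap K _ (p : K) ^ n * x) := by
  have h0 := W.base_irreducible_pos hp
  have h1 := W.base_irreducible_lt_one hp
  obtain ⟨n, hn1, hn2⟩ := NNReal.exists_mem_Ioc_zpow (x := W.w x) (y := (W.base (p : K))⁻¹)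
    ((Valuation.ne_zero_iff _).2 hx) ((one_lt_inv₀ h0).2 h1)
  have e : (W.base (p : K)) ^ (n + 1) * (W.base (p : K))⁻¹ ^ (n + 1) = 1 := by
    rw [← mul_zpow, mul_inv_cancel₀ h0.ne', one_zpow]
  have e' : (W.base (p : K)) ^ (n + 1) * (W.base (p : K))⁻¹ ^ n = W.base (p : K) := by
    rw [zpow_add_one₀ h0.ne', mul_right_comm, ← mul_zpow, mul_inv_cancel₀ h0.ne', one_zpow, one_mul]
  refine ⟨n + 1, ?_, ?_⟩
  · rw [map_mul, map_zpow₀, w_algebraMap]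
    calc _ ≤ (W.base (p : K)) ^ (n + 1) * (W.base (p : K))⁻¹ ^ (n + 1) := by gcongr
      _ = 1 := e
  · rw [map_mul, map_zpow₀, w_algebraMap]
    calc W.base (p : K) = (W.base (p : K)) ^ (n + 1) * (W.base (p : K))⁻¹ ^ n := e'.symm
      _ < _ := by
        have := zpow_pos h0 (n + 1)
        gcongr

theorem exists_base_eq_zpow {p : v.valuationSubring} (hp : Irreducible p) {a : K} (ha : a ≠ 0) :
    ∃ n : ℤ, W.base a = W.base (p : K) ^ n := by
  obtain ⟨n, h1, h2⟩ := W.exists_zpow_mul hp (x := algebraMap K _ a) (by simpa using ha)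
  rw [← map_zpow₀, ← map_mul, w_algebraMap] at h1 h2
  have h3 : W.base ((p : K) ^ n * a) = 1 := by
    by_contra hne
    exact h2.not_ge (W.base_le_of_lt_one hp (lt_of_le_of_ne h1 hne))
  refine ⟨-n, ?_⟩
  rw [map_mul, map_zpow₀] at h3
  rw [zpow_neg]
  exact eq_inv_of_mul_eq_one_right h3

theorem isUniformizerOf_of_base_eq {p : v.valuationSubring} (hp : Irreducible p) (ϖ : Kˣ)
    (h : W.base (ϖ : K) = W.base (p : K)) : IsUniformizerOf v ϖ := by
  have hp0 : (p : K) ≠ 0 := fun h0 => hp.ne_zero (Subtype.ext h0)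
  have h1 : W.base ((ϖ : K) / p) = 1 := by
    rw [map_div₀, h, div_self (W.base_irreducible_pos hp).ne']
  have hu : IsUnit (⟨(ϖ : K) / p, (W.base_le_one_iff _).1 h1.le⟩ : v.valuationSubring) :=
    (W.isUnit_base_iff _).2 h1
  refine ⟨p * ⟨(ϖ : K) / p, (W.base_le_one_iff _).1 h1.le⟩, ?_, ?_⟩
  · exact (associated_mul_unit_right p _ hu).irreducible hp
  · change (p : K) * (ϖ / p) = ϖ
    field_simp

/-! ### Unramified characters -/

/-- After scaling into the fundamental domain the element is a unit, since non-units of an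
unramified extension are divisible by `p`. -/
theorem exists_w_eq_zpow_of_isUnramified {p : v.valuationSubring} (hp : Irreducible p)
    {χ : GalChar K} (hχ : χ.IsUnramified v) {x : SepCl K} (hx : x ≠ 0) (hxχ : x ∈ χ.field) :
    ∃ n : ℤ, W.w x = W.base (p : K) ^ n := by
  obtain ⟨n, h1, h2⟩ := W.exists_zpow_mul hp hx
  have hmem : algebraMap K _ (p : K) ^ n * x ∈ χ.field :=
    mul_mem (zpow_mem (χ.field.algebraMap_mem _) n) hxχ
  have h3 : W.w (algebraMap K _ (p : K) ^ n * x) = 1 := by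
    by_contra hne
    obtain ⟨c, hc⟩ := hχ p hp ⟨_, (W.le_one_iff _).1 h1⟩ hmem
      ((W.not_isUnit_iff _).2 (lt_of_le_of_ne h1 hne))
    have hc' : algebraMap K _ (p : K) ^ n * x = algebraMap K _ (p : K) * (c : SepCl K) :=
      congrArg Subtype.val hc
    rw [hc', map_mul, w_algebraMap] at h2
    exact h2.not_ge (mul_le_of_le_one_right' ((W.le_one_iff _).2 c.2))
  refine ⟨-n, ?_⟩
  rw [map_mul, map_zpow₀, w_algebraMap] at h3
  rw [zpow_neg]
  exact eq_inv_of_mul_eq_one_right h3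

theorem _root_.GalChar.exists_pow_eq_one (χ : GalChar K) (σ : AbsGal K) :
    ∃ n : ℕ, 0 < n ∧ χ.toHom (σ ^ n) = 1 := by
  refine ⟨(χ.lift σ).den, (χ.lift σ).den_pos, ?_⟩
  rw [map_pow, ← toAdd_eq_zero, toAdd_pow, ← χ.coe_lift, ← AddCircle.coe_nsmul,
    AddCircle.coe_eq_zero_iff]
  exact ⟨(χ.lift σ).num, by simp⟩

/-- The cup product of a nontrivial unramified character with a uniformizer is nontrivial. -/
theorem eq_one_of_cup_eq_one (W : ExtVal v) {χ : GalChar K} (hχ : χ.IsUnramified v) {ϖ : Kˣ}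
    (hϖ : IsUniformizerOf v ϖ) (h : χ.cup ϖ = 1) (σ : AbsGal K) : χ.toHom σ = 1 := by
  obtain ⟨p, hp, hpϖ⟩ := hϖ
  obtain ⟨x, hx, hx1, hxf⟩ := χ.exists_cochain_of_cup_eq_one ϖ h
  have hp0 := W.base_irreducible_pos hp
  have hp1 := W.base_irreducible_lt_one hp
  set l : ℝ := Real.log (W.base (p : K)) with hl
  have hl0 : l < 0 := Real.log_neg hp0 hp1
  -- Galois invariance of the valuation turns the multiplicative relation into an additive one with
  -- trivial action.
  have hval : ∀ g h, Real.log (W.w (x h : SepCl K)) + Real.log (W.w (x g : SepCl K)) =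
      χ.delta g h * l + Real.log (W.w (x (g * h) : SepCl K)) := by
    intro g h
    have h1 : (g (x h : SepCl K)) * (x g : SepCl K) =
        algebraMap K _ (p : K) ^ χ.delta g h * x (g * h) := by
      have h2 := congrArg Units.val (hx g h)
      rw [Units.val_mul, Units.val_mul, Units.val_zpow_eq_zpow_val] at h2
      rw [hpϖ]
      exact h2
    have h2 := congrArg (fun z => Real.log (W.w z)) h1
    have hne : ∀ u : (SepCl K)ˣ, (W.w (u : SepCl K) : ℝ) ≠ 0 := fun u => by
      have := (Valuation.ne_zero_iff W.w).2 u.ne_zero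
      exact_mod_cast this
    simp only [map_mul, W.map_galois, map_zpow₀, w_algebraMap, NNReal.coe_mul,
      NNReal.coe_zpow] at h2
    rwa [Real.log_mul (hne _) (hne _), Real.log_mul (zpow_ne_zero _ (by exact_mod_cast hp0.ne'))
      (hne _), Real.log_zpow] at h2
  -- Over `ℝ` the cocycle `δχ` is the coboundary of the lift; subtracting it leaves a homomorphism,
  -- which vanishes because it kills a power of every element and `ℝ` is torsion-free.
  let f : AbsGal K →* Multiplicative ℝ :=
    { toFun := fun g => Multiplicative.ofAdd
        (Real.log (W.w (x g : SepCl K)) - (χ.lift g : ℝ) * l)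
      map_one' := by
        rw [hx1 1 (map_one _), (χ.lift_eq_zero_iff 1).2 (map_one _)]
        simp
      map_mul' := fun g h => by
        rw [← ofAdd_add]
        congr 1
        have h1 := hval g h
        have h2 : (χ.delta g h : ℝ) = χ.lift h - χ.lift (g * h) + χ.lift g := by
          exact_mod_cast congrArg (fun q : ℚ => (q : ℝ)) (χ.coe_delta g h)
        rw [h2] at h1
        linear_combination -h1 }
  have hf : ∀ g, Real.log (W.w (x g : SepCl K)) = (χ.lift g : ℝ) * l := by
    intro g
    obtain ⟨n, hn, hgn⟩ := χ.exists_pow_eq_one g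
    have h1 : f (g ^ n) = 1 := by
      change Multiplicative.ofAdd (Real.log (W.w (x (g ^ n) : SepCl K)) -
        (χ.lift (g ^ n) : ℝ) * l) = 1
      rw [hx1 _ hgn, (χ.lift_eq_zero_iff _).2 hgn]
      simp
    rw [map_pow] at h1
    have h2 : n • (Real.log (W.w (x g : SepCl K)) - (χ.lift g : ℝ) * l) = 0 :=
      congrArg Multiplicative.toAdd h1
    rw [nsmul_eq_mul, mul_eq_zero] at h2
    rcases h2 with h2 | h2
    · exact absurd h2 (by exact_mod_cast hn.ne')
    · linarith
  obtain ⟨n, hn⟩ := W.exists_w_eq_zpow_of_isUnramified hp hχ (x σ).ne_zero (hxf σ)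
  have h1 := hf σ
  rw [hn, NNReal.coe_zpow, Real.log_zpow] at h1
  -- Unramifiedness makes the lift an integer in `[0, 1)`.
  have h2 : (n : ℝ) = (χ.lift σ : ℝ) := mul_right_cancel₀ hl0.ne h1
  have h3 : (n : ℚ) = χ.lift σ := by exact_mod_cast h2
  have h4 := χ.lift_nonneg σ
  have h5 := χ.lift_lt_one σ
  rw [← h3] at h4 h5
  have h6 : n = 0 := by
    have : 0 ≤ n := by exact_mod_cast h4
    have : n < 1 := by exact_mod_cast h5
    omega
  rw [← χ.lift_eq_zero_iff, ← h3, h6, Int.cast_zero]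

/-! ### The residue field -/

instance [CharP K 2] : CharP (IsLocalRing.ResidueField v.valuationSubring) 2 :=
  CharTwo.of_one_ne_zero_of_two_eq_zero one_ne_zero (by
    have : (2 : v.valuationSubring) = 0 := Subtype.ext (CharTwo.two_eq_zero : (2 : K) = 0)
    have h := congrArg (IsLocalRing.residue v.valuationSubring) this
    rwa [map_zero, map_ofNat] at h)

variable [Finite (IsLocalRing.ResidueField v.valuationSubring)]

theorem base_pow_card_sub_lt_one {a : K} (ha : W.base a ≤ 1) :
    W.base (a ^ Nat.card (IsLocalRing.ResidueField v.valuationSubring) - a) < 1 := by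
  have := Fintype.ofFinite (IsLocalRing.ResidueField v.valuationSubring)
  rw [Nat.card_eq_fintype_card]
  set x : v.valuationSubring := ⟨a, (W.base_le_one_iff a).1 ha⟩
  have h := (W.residue_eq_zero_iff
    (x ^ Fintype.card (IsLocalRing.ResidueField v.valuationSubring) - x)).1 (by
      rw [map_sub, map_pow, FiniteField.pow_card, sub_self])
  exact h

/-- An integer whose residue is fixed by the Frobenius of `K` is congruent to an integer of `K`. -/
theorem exists_base_of_pow_card_sub_lt_one {x : SepCl K} (hx : W.w x ≤ 1)
    (h : W.w (x ^ Nat.card (IsLocalRing.ResidueField v.valuationSubring) - x) < 1) :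
    ∃ a : K, W.base a ≤ 1 ∧ W.w (x - algebraMap K _ a) < 1 := by
  classical
  set κ := IsLocalRing.ResidueField v.valuationSubring with hκ
  have := Fintype.ofFinite κ
  rw [Nat.card_eq_fintype_card] at h
  let s : κ → v.valuationSubring := Function.surjInv IsLocalRing.residue_surjective
  have hs : ∀ c, IsLocalRing.residue v.valuationSubring (s c) = c :=
    Function.surjInv_eq IsLocalRing.residue_surjective
  -- `X^q - X` splits over the residue field, so `P` has coefficients in the maximal ideal. Hence `∏
  -- (x - s c)` is small, and so is one of its factors.
  let P : (v.valuationSubring)[X] := ∏ c : κ, (X - C (s c)) - (X ^ Fintype.card κ - X)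
  have hP : P.map (IsLocalRing.residue v.valuationSubring) = 0 := by
    have hcard := FiniteField.X_pow_card_sub_X_natDegree_eq κ (Fintype.one_lt_card (α := κ))
    have hroots := FiniteField.roots_X_pow_card_sub_X κ
    have hmonic : (X ^ Fintype.card κ - X : κ[X]).Monic :=
      monic_X_pow_sub (by rw [degree_X]; exact_mod_cast Fintype.one_lt_card (α := κ))
    have h1 := prod_multiset_X_sub_C_of_monic_of_roots_card_eq hmonic (by
      rw [hroots, hcard]; rfl)
    rw [hroots] at h1
    have h2 : ∏ c : κ, (X - C c) = (X ^ Fintype.card κ - X : κ[X]) := h1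
    simp only [P, Polynomial.map_sub, Polynomial.map_prod, Polynomial.map_pow, map_X, map_C, hs, h2,
      sub_self]
  have hPx : W.w (aeval x P) < 1 := by
    rw [aeval_eq_sum_range]
    refine W.w.map_sum_lt one_ne_zero (fun i _ => ?_)
    have h1 : W.base (P.coeff i : K) < 1 := by
      rw [← W.residue_eq_zero_iff, ← coeff_map, hP, coeff_zero]
    rw [Algebra.smul_def, map_mul, map_pow]
    change W.base (P.coeff i : K) * _ < 1
    exact mul_lt_one_of_lt_of_le h1 (pow_le_one' hx i)
  have hprod : W.w (∏ c : κ, (x - algebraMap K _ (s c : K))) < 1 := by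
    have h1 : ∏ c : κ, (x - algebraMap K _ (s c : K)) =
        aeval x P + (x ^ Fintype.card κ - x) := by
      simp only [P, map_sub, map_prod, map_pow, aeval_X, aeval_C]
      rw [sub_add_cancel]
      rfl
    rw [h1]
    exact W.w.map_add_lt hPx h
  by_contra! hcon
  rw [map_prod] at hprod
  refine hprod.not_ge (Finset.one_le_prod' fun c _ => ?_)
  exact hcon _ ((W.base_le_one_iff _).2 (s c).2)

/-- A finite field of characteristic two is perfect. -/
theorem exists_sq_sub_lt_one [CharP K 2] {a : K} (ha : W.base a ≤ 1) :
    ∃ c : K, W.base c ≤ 1 ∧ W.base (a - c ^ 2) < 1 := by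
  obtain ⟨c, hc⟩ := FiniteField.isSquare_of_char_two
    (ringChar.eq (IsLocalRing.ResidueField v.valuationSubring) 2)
    (IsLocalRing.residue v.valuationSubring ⟨a, (W.base_le_one_iff a).1 ha⟩)
  obtain ⟨c, rfl⟩ := IsLocalRing.residue_surjective c
  refine ⟨c, (W.base_le_one_iff _).2 c.2, ?_⟩
  exact (W.residue_eq_zero_iff (⟨a, (W.base_le_one_iff a).1 ha⟩ - c ^ 2)).1 (by
    rw [map_sub, hc, map_pow]
    ring)

/-- An unramified character is determined by its value at the Frobenius. -/
theorem eq_one_of_isFrobenius (W : ExtVal v) {p : v.valuationSubring} (hp : Irreducible p)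
    {χ : GalChar K} (hχ : χ.IsUnramified v) {F : AbsGal K} (hF : χ.IsFrobenius v F)
    (hχF : χ.toHom F = 1)
    (σ : AbsGal K) : χ.toHom σ = 1 := by
  have hp0 : algebraMap K (SepCl K) (p : K) ≠ 0 := by
    rw [Ne, map_eq_zero]
    exact fun h0 => hp.ne_zero (Subtype.ext h0)
  -- Since `F` fixes `z`, the residue of `z` is fixed by the `q`-th power, so `z` is congruent to
  -- some `a` in `K`. As the extension is unramified, `(z - a)/p` is again integral and the argument
  -- repeats.
  have happ : ∀ n : ℕ, ∀ z ∈ χ.field, W.w z ≤ 1 →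
      ∃ a : K, W.w (z - algebraMap K _ a) ≤ W.base (p : K) ^ n := by
    intro n
    induction n with
    | zero => exact fun z _ hz => ⟨0, by simpa using hz⟩
    | succ n ih =>
      intro z hz hz1
      obtain ⟨y, hy, hyz⟩ := hF ⟨z, (W.le_one_iff z).1 hz1⟩ hz
      have hFz : F z = z := (IntermediateField.mem_fixedField_iff _ _).1 hz F hχF
      rw [W.not_isUnit_iff, hyz, hFz, Valuation.map_sub_swap] at hy
      obtain ⟨a, ha, haz⟩ := W.exists_base_of_pow_card_sub_lt_one hz1 hy
      have hmem : z - algebraMap K _ a ∈ χ.field := sub_mem hz (χ.field.algebraMap_mem a)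
      obtain ⟨c, hc⟩ := hχ p hp ⟨_, (W.le_one_iff _).1 haz.le⟩ hmem ((W.not_isUnit_iff _).2 haz)
      have hc' : z - algebraMap K _ a = algebraMap K _ (p : K) * (c : SepCl K) :=
        congrArg Subtype.val hc
      have hcm : (c : SepCl K) ∈ χ.field := by
        have : (c : SepCl K) = (z - algebraMap K _ a) / algebraMap K _ (p : K) := by
          rw [hc', mul_div_cancel_left₀ _ hp0]
        rw [this]
        exact div_mem hmem (χ.field.algebraMap_mem _)
      obtain ⟨b, hb⟩ := ih c hcm ((W.le_one_iff _).2 c.2)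
      refine ⟨a + p * b, ?_⟩
      have : z - algebraMap K _ (a + p * b) = algebraMap K _ (p : K) * (c - algebraMap K _ b) := by
        rw [map_add, map_mul]
        linear_combination hc'
      rw [this, map_mul, w_algebraMap, pow_succ, mul_comm]
      gcongr
  refine χ.eq_one_of_field_le_bot (fun z hz => ?_) σ
  rw [IntermediateField.mem_bot]
  by_cases hz0 : z = 0
  · exact ⟨0, by rw [hz0, map_zero]⟩
  obtain ⟨n, hn, -⟩ := W.exists_zpow_mul hp hz0
  obtain ⟨a, ha⟩ := W.mem_range_of_approx (algebraMap K _ (p : K) ^ n * z) (fun ε hε => by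
    obtain ⟨m, hm⟩ := NNReal.exists_pow_lt_of_lt_one hε (W.base_irreducible_lt_one hp)
    obtain ⟨a, ha⟩ := happ m _ (mul_mem (zpow_mem (χ.field.algebraMap_mem _) n) hz) hn
    exact ⟨a, ha.trans_lt hm⟩)
  refine ⟨a / (p : K) ^ n, ?_⟩
  rw [map_div₀, ha, map_zpow₀, mul_div_cancel_left₀ _ (zpow_ne_zero n hp0)]

end ExtVal

end ExtVal

/-! ## The local symbol in characteristic two -/

namespace ExtVal

section CharTwo

variable {K : Type*} [Field K] [CharP K 2] {Γ : Type*} [LinearOrderedCommGroupWithZero Γ]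
  {v : Valuation K Γ} (W : ExtVal v)

/-- Elements of the maximal ideal are of the form `z² - z`. -/
theorem exists_sq_sub_self_eq {c : K} (hc : W.base c < 1) : ∃ z : K, z ^ 2 - z = c := by
  have h2 : (2 : SepCl K) = 0 := CharTwo.two_eq_zero
  obtain ⟨β, hβ, hβ1⟩ : ∃ β : SepCl K, β ^ 2 - β = algebraMap K _ c ∧ W.w β < 1 := by
    have hα := artinSchreierRoot_spec c
    -- The roots `α` and `α - 1` have product `c`, of value less than one, so one of them is small.
    set α := artinSchreierRoot c
    have h : W.w α * W.w (α - 1) < 1 := by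
      rwa [← map_mul, mul_sub, mul_one, ← sq, hα]
    by_cases h1 : W.w α < 1
    · exact ⟨α, hα, h1⟩
    · refine ⟨α - 1, by linear_combination hα + (1 - α) * h2, ?_⟩
      by_contra h3
      exact h.not_ge (one_le_mul (not_lt.1 h1) (not_lt.1 h3))
  -- Iterating `β = β² - c` from `a = 0` gives approximations in `K` with error `β^(2^n)`.
  have happ : ∀ n : ℕ, ∃ a : K, β - algebraMap K _ a = β ^ 2 ^ n := by
    intro n
    induction n with
    | zero => exact ⟨0, by simp⟩
    | succ n ih =>
      obtain ⟨a, ha⟩ := ih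
      refine ⟨-(c + a ^ 2), ?_⟩
      rw [pow_succ 2 n, pow_mul, ← ha, map_neg, map_add, map_pow, ← hβ]
      linear_combination β * algebraMap K _ a * h2
  obtain ⟨z, hz⟩ := W.mem_range_of_approx β (fun ε hε => by
    obtain ⟨m, hm⟩ := NNReal.exists_pow_lt_of_lt_one hε hβ1
    obtain ⟨a, ha⟩ := happ m
    refine ⟨a, ?_⟩
    rw [ha, map_pow]
    exact (pow_le_pow_right_of_le_one' hβ1.le (Nat.lt_two_pow_self).le).trans_lt hm)
  refine ⟨z, (algebraMap K (SepCl K)).injective ?_⟩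
  rw [map_sub, map_pow, hz, hβ]

/-! ### Unramified Artin–Schreier characters -/

theorem w_artinSchreierRoot_le_one {a : K} (ha : W.base a ≤ 1) :
    W.w (artinSchreierRoot a) ≤ 1 := by
  by_contra! hlt
  have h1 := congrArg W.w (artinSchreierRoot_spec a)
  have h2 : W.w (artinSchreierRoot a) < W.w (artinSchreierRoot a ^ 2) := by
    rw [map_pow, sq]
    exact lt_mul_of_one_lt_left (zero_lt_one.trans hlt) hlt
  rw [Valuation.map_sub_eq_of_lt_left _ h2, w_algebraMap, map_pow] at h1
  rw [← h1] at ha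
  exact ha.not_gt (one_lt_pow₀ hlt two_ne_zero)

/-- The integral basis `1, α` of an unramified Artin–Schreier extension. -/
theorem max_le_w_add_mul {a : K} (ha : W.base a ≤ 1)
    (hnt : ∃ σ, (artinSchreierChar a).toHom σ ≠ 1) (x y : K) :
    max (W.base x) (W.base y) ≤
      W.w (algebraMap K _ x + algebraMap K _ y * artinSchreierRoot a) := by
  have hα := W.w_artinSchreierRoot_le_one ha
  rcases lt_or_ge (W.base y) (W.base x) with hlt | hle
  · have h1 : W.w (algebraMap K _ y * artinSchreierRoot a) < W.w (algebraMap K _ x) := by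
      rw [map_mul, w_algebraMap, w_algebraMap]
      exact (mul_le_of_le_one_right' hα).trans_lt hlt
    rw [max_eq_left hlt.le, Valuation.map_add_eq_of_lt_left _ h1, w_algebraMap]
  rw [max_eq_right hle]
  by_cases hy : y = 0
  · simp [hy]
  have hs : W.base (x / y) ≤ 1 := by
    rw [map_div₀]
    exact div_le_one_of_le₀ hle zero_le
  -- If this norm were small it would equal `z² - z`, and `z + x/y` would be a root of `X² - X - a`
  -- in `K`, making the character trivial.
  have hd : 1 ≤ W.base ((x / y) ^ 2 + (x / y) * 1 + a * 1 ^ 2) := by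
    by_contra! hlt
    obtain ⟨z, hz⟩ := W.exists_sq_sub_self_eq hlt
    obtain ⟨σ, hσ⟩ := hnt
    refine hσ (artinSchreierChar_eq_one_of_eq (β := z + x / y) ?_ σ)
    linear_combination hz + (z * (x / y) + (x / y) ^ 2) *
      (CharTwo.two_eq_zero : (2 : K) = 0)
  rw [← w_algebraMap, ← artinSchreier_mul_conj, map_mul, map_one, one_mul, one_mul] at hd
  have h1 : W.w (algebraMap K _ (x / y) + (artinSchreierRoot a + 1)) ≤ 1 :=
    W.w.map_add_le hs (W.w.map_add_le hα (map_one _).le)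
  have h2 : 1 ≤ W.w (algebraMap K _ (x / y) + artinSchreierRoot a) :=
    hd.trans (mul_le_of_le_one_right' h1)
  have h3 : algebraMap K _ x + algebraMap K _ y * artinSchreierRoot a =
      algebraMap K _ y * (algebraMap K _ (x / y) + artinSchreierRoot a) := by
    rw [mul_add, ← map_mul, mul_div_cancel₀ _ hy]
  rw [h3, map_mul, w_algebraMap]
  exact le_mul_of_one_le_right' h2

/-- With the integral basis `1, α`, both coordinates of a non-unit are non-units of `K`, hence
divisible by `p`. -/
theorem isUnramified_artinSchreierChar {a : K} (ha : W.base a ≤ 1)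
    (hnt : ∃ σ, (artinSchreierChar a).toHom σ ≠ 1) : (artinSchreierChar a).IsUnramified v := by
  intro p hp x hxf hxu
  obtain ⟨y, z, hyz⟩ := exists_eq_add_mul_of_mem_field hxf
  have hmax := W.max_le_w_add_mul ha hnt y z
  rw [W.not_isUnit_iff, hyz] at hxu
  have hy := W.base_le_of_lt_one hp (((le_max_left _ _).trans hmax).trans_lt hxu)
  have hz := W.base_le_of_lt_one hp (((le_max_right _ _).trans hmax).trans_lt hxu)
  have hle : W.w (x : SepCl K) ≤ W.base (p : K) := by
    rw [hyz]
    refine W.w.map_add_le hy ?_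
    rw [map_mul, w_algebraMap]
    exact (mul_le_of_le_one_right' (W.w_artinSchreierRoot_le_one ha)).trans hz
  have hp0 : algebraMap K (SepCl K) (p : K) ≠ 0 := by
    rw [Ne, map_eq_zero]
    exact fun h0 => hp.ne_zero (Subtype.ext h0)
  refine ⟨⟨(x : SepCl K) / algebraMap K _ (p : K), (W.le_one_iff _).1 ?_⟩, ?_⟩
  · rw [map_div₀, w_algebraMap]
    exact div_le_one_of_le₀ hle zero_le
  · ext1
    exact (mul_div_cancel₀ _ hp0).symm

variable [Finite (IsLocalRing.ResidueField v.valuationSubring)]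

variable (v) in
theorem exists_card_eq_two_pow :
    ∃ n : ℕ, Nat.card (IsLocalRing.ResidueField v.valuationSubring) = 2 ^ n := by
  have := Fintype.ofFinite (IsLocalRing.ResidueField v.valuationSubring)
  obtain ⟨n, -, hn⟩ := FiniteField.card (IsLocalRing.ResidueField v.valuationSubring) 2
  exact ⟨n, by rw [Nat.card_eq_fintype_card, hn]⟩

/-- As `a^q ≡ a`, the power `α^q` is congruent to `α` or to `α + 1 = s α`. The first would make `α`
congruent to an element of `K`, against the integral basis. -/
theorem isFrobenius_artinSchreierChar {a : K} (ha : W.base a ≤ 1) {s : AbsGal K}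
    (hs : (artinSchreierChar a).toHom s ≠ 1) : (artinSchreierChar a).IsFrobenius v s := by
  intro x hxf
  obtain ⟨n, hn⟩ := exists_card_eq_two_pow v
  set q := Nat.card (IsLocalRing.ResidueField v.valuationSubring) with hq
  have h2 : (2 : SepCl K) = 0 := CharTwo.two_eq_zero
  have hα := W.w_artinSchreierRoot_le_one ha
  have hspec := artinSchreierRoot_spec a
  have hsα := artinSchreierRoot_apply_of_ne_one a hs
  have hbasis := W.max_le_w_add_mul ha ⟨s, hs⟩
  obtain ⟨y, z, hyz⟩ := exists_eq_add_mul_of_mem_field hxf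
  set α := artinSchreierRoot a
  have hx1 : W.w (x : SepCl K) ≤ 1 := (W.le_one_iff _).2 x.2
  have hy : W.base y ≤ 1 := (le_max_left _ _).trans ((hbasis y z).trans (hyz ▸ hx1))
  have hz : W.base z ≤ 1 := (le_max_right _ _).trans ((hbasis y z).trans (hyz ▸ hx1))
  have hαq : W.w (α + 1 - α ^ q) < 1 := by
    have hprod : W.w (α ^ q - α) * W.w (α + 1 - α ^ q) < 1 := by
      have e1 : (α ^ q) ^ 2 - α ^ q = algebraMap K _ (a ^ q) := by
        rw [map_pow, ← hspec, hn, sub_pow_char_pow, ← pow_mul, ← pow_mul, mul_comm]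
      have e2 : (α ^ q - α) * (α + 1 - α ^ q) = algebraMap K _ (a ^ q - a) := by
        rw [map_sub, ← e1, ← hspec]
        linear_combination (α ^ q * α - (α ^ q) ^ 2 + α ^ q - α) * h2
      rw [← map_mul, e2, w_algebraMap]
      exact W.base_pow_card_sub_lt_one ha
    by_contra hge
    have h3 : W.w (α ^ q - α) < 1 := by
      by_contra hge'
      exact hprod.not_ge (one_le_mul (not_lt.1 hge') (not_lt.1 hge))
    obtain ⟨c, hc, hcα⟩ := W.exists_base_of_pow_card_sub_lt_one hα h3
    have h4 := (le_max_right _ _).trans (hbasis (-c) 1)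
    rw [map_one, map_one, one_mul, map_neg, neg_add_eq_sub] at h4
    exact hcα.not_ge h4
  have hdiff : W.w (s x - (x : SepCl K) ^ q) < 1 := by
    have e : s x - (x : SepCl K) ^ q = algebraMap K _ z * (α + 1 - α ^ q) -
        (algebraMap K _ (y ^ q - y) + algebraMap K _ (z ^ q - z) * α ^ q) := by
      have e1 : (x : SepCl K) ^ q = algebraMap K _ y ^ q + algebraMap K _ z ^ q * α ^ q := by
        rw [hyz, hn, add_pow_char_pow, mul_pow]
      rw [e1, hyz, map_add, map_mul, AlgEquiv.commutes, AlgEquiv.commutes, hsα, map_sub, map_sub,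
        map_pow, map_pow]
      ring
    rw [e]
    refine W.w.map_sub_lt ?_ (W.w.map_add_lt (W.base_pow_card_sub_lt_one hy) ?_)
    · rw [map_mul]
      exact mul_lt_one_of_nonneg_of_lt_one_right hz zero_le hαq
    · rw [map_mul, map_pow]
      exact mul_lt_one_of_lt_of_le (W.base_pow_card_sub_lt_one hz) (pow_le_one' hα q)
  exact ⟨⟨_, (W.le_one_iff _).1 hdiff.le⟩, (W.not_isUnit_iff _).2 hdiff, rfl⟩

/-! ### Reduction of symbols to unramified ones -/

/-- Remove the leading term of `a`, of even pole order `2m`, by an element `z² - z`. -/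
theorem exists_reduce_even {p : v.valuationSubring} (hp : Irreducible p) {a : K} {m : ℕ}
    (ha : W.base a ≤ (W.base (p : K) ^ (2 * (m + 1)))⁻¹) :
    ∃ a' : K, W.base a' ≤ (W.base (p : K) ^ (2 * m + 1))⁻¹ ∧
      ∀ b : Kˣ, serreSymbol a b = serreSymbol a' b := by
  have hp0 := W.base_irreducible_pos hp
  have hp1 := W.base_irreducible_lt_one hp
  have hpK : (p : K) ≠ 0 := fun h0 => hp.ne_zero (Subtype.ext h0)
  have h1 : W.base (a * (p : K) ^ (2 * (m + 1))) ≤ 1 := by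
    rw [map_mul, map_pow]
    rwa [← le_div_iff₀ (by positivity), one_div]
  obtain ⟨c, hc, hca⟩ := W.exists_sq_sub_lt_one h1
  -- `d²` cancels the leading term, while `d` has a pole of order at most `m + 1 ≤ 2m + 1`.
  set d := c / (p : K) ^ (m + 1) with hd
  refine ⟨a - (d ^ 2 - d), ?_, fun b => ?_⟩
  · have e : a - (d ^ 2 - d) = (a * (p : K) ^ (2 * (m + 1)) - c ^ 2) / (p : K) ^ (2 * (m + 1))
        + d := by
      rw [hd]
      field_simp
      ring
    rw [e]
    refine W.base.map_add_le ?_ ?_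
    · rw [map_div₀, map_pow, div_le_iff₀ (by positivity)]
      refine (W.base_le_of_lt_one hp hca).trans_eq ?_
      rw [mul_add, mul_one, show 2 * m + 2 = (2 * m + 1) + 1 by ring, pow_succ _ (2 * m + 1),
        inv_mul_cancel_left₀ (by positivity)]
    · rw [hd, map_div₀, map_pow, div_le_iff₀ (by positivity)]
      refine hc.trans ?_
      rw [inv_mul_eq_div, one_le_div₀ (by positivity)]
      exact pow_le_pow_right_of_le_one' hp1.le (by omega)
  · have h3 := serreSymbol_add (a - (d ^ 2 - d)) (d ^ 2 - d) b
    rw [sub_add_cancel, serreSymbol_sq_sub_self, mul_one] at h3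
    exact h3

/-- The symbol `[a, ϖ)` for a uniformizer `ϖ` depends only on an integral part of `a`. -/
theorem exists_serreSymbol_uniformizer {ϖ : Kˣ} (hϖ : IsUniformizerOf v ϖ) (n : ℕ) (a : K)
    (ha : W.base a ≤ (W.base (ϖ : K) ^ n)⁻¹) :
    ∃ a₀ : K, W.base a₀ ≤ 1 ∧ serreSymbol a ϖ = serreSymbol a₀ ϖ := by
  obtain ⟨p, hp, hpϖ⟩ := hϖ
  have hp0 := W.base_irreducible_pos hp
  have hp1 := W.base_irreducible_lt_one hp
  have hpK : (p : K) ≠ 0 := fun h0 => hp.ne_zero (Subtype.ext h0)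
  rw [← hpϖ] at ha
  induction n generalizing a with
  | zero => exact ⟨a, by simpa using ha, rfl⟩
  | succ n ih =>
    obtain ⟨m, hm | hm⟩ := n.even_or_odd'
    -- The pole order `n + 1 = 2m + 1` is odd, so the leading term is `ϖd²` with `d = c/ϖ^(m+1)`,
    -- and `[ϖd², ϖ) = [ϖd², ϖd²) = 1`.
    · have h1 : W.base (a * (p : K) ^ (n + 1)) ≤ 1 := by
        rw [map_mul, map_pow]
        rwa [← le_div_iff₀ (by positivity), one_div]
      obtain ⟨c, hc, hca⟩ := W.exists_sq_sub_lt_one h1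
      have hle : W.base (a - c ^ 2 / (p : K) ^ (n + 1)) ≤ (W.base (p : K) ^ n)⁻¹ := by
        have e : a - c ^ 2 / (p : K) ^ (n + 1) =
            (a * (p : K) ^ (n + 1) - c ^ 2) / (p : K) ^ (n + 1) := by
          field_simp
        rw [e, map_div₀, map_pow, div_le_iff₀ (by positivity)]
        refine (W.base_le_of_lt_one hp hca).trans_eq ?_
        rw [pow_succ, inv_mul_cancel_left₀ (by positivity)]
      obtain ⟨a₀, ha₀, h⟩ := ih _ hle
      refine ⟨a₀, ha₀, ?_⟩
      have h3 := serreSymbol_add (a - c ^ 2 / (p : K) ^ (n + 1)) (c ^ 2 / (p : K) ^ (n + 1)) ϖ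
      rw [sub_add_cancel] at h3
      rw [h3, h]
      suffices hs : serreSymbol (c ^ 2 / (p : K) ^ (n + 1)) ϖ = 1 by rw [hs, mul_one]
      by_cases hc0 : c = 0
      · have := serreSymbol_sq_sub_self (0 : K) ϖ
        simpa [hc0] using this
      · set d : Kˣ := Units.mk0 c hc0 / ϖ ^ (m + 1) with hd
        have e : c ^ 2 / (p : K) ^ (n + 1) = ((ϖ * d ^ 2 : Kˣ) : K) := by
          rw [hd, hpϖ, hm]
          push_cast
          rw [Units.val_mk0]
          have := ϖ.ne_zero
          field_simp
          ring
        rw [e, ← serreSymbol_mul_sq _ ϖ d]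
        exact serreSymbol_self _
    · obtain ⟨a', ha', h⟩ := W.exists_reduce_even hp (a := a) (m := m)
        (by rwa [show 2 * (m + 1) = n + 1 by omega])
      obtain ⟨a₀, ha₀, h0⟩ := ih a' (by rwa [hm])
      exact ⟨a₀, ha₀, (h ϖ).trans h0⟩

/-- The norm of an unramified Artin–Schreier extension is surjective on units. -/
theorem serreSymbol_eq_one_of_unit {a : K} (ha : W.base a ≤ 1) {u : Kˣ}
    (hu : W.base (u : K) = 1) : serreSymbol a u = 1 := by
  rw [serreSymbol_eq_one_iff]
  obtain ⟨c, hc, hcu⟩ := W.exists_sq_sub_lt_one hu.le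
  have hc1 : W.base c = 1 := by
    by_contra hne
    have h1 : W.base (c ^ 2) < 1 := by
      rw [map_pow]
      exact pow_lt_one₀ zero_le (lt_of_le_of_ne hc hne) two_ne_zero
    have h2 := W.base.map_add_lt hcu h1
    rw [sub_add_cancel, hu] at h2
    exact lt_irrefl _ h2
  have hc0 : c ≠ 0 := by
    rintro rfl
    simp at hc1
  by_cases ha0 : a = 0
  · exact ⟨c, (u - c ^ 2) / c, by rw [ha0]; field_simp; ring⟩
  -- Setting `x = c` and `y = cs/a` in `x² + xy + ay² = u` leaves exactly this equation for `s² -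
  -- s`.
  obtain ⟨s, hs⟩ := W.exists_sq_sub_self_eq (c := a * (u - c ^ 2) / c ^ 2) (by
    rw [map_div₀, map_mul, map_pow, hc1, one_pow, div_one]
    exact mul_lt_one_of_nonneg_of_lt_one_right ha zero_le hcu)
  refine ⟨c, c * s / a, ?_⟩
  have h2 : (2 : K) = 0 := CharTwo.two_eq_zero
  have e : c ^ 2 + c * (c * s / a) + a * (c * s / a) ^ 2 =
      c ^ 2 + c ^ 2 / a * (s ^ 2 - s) + 2 * (c ^ 2 * s / a) := by
    field_simp
    ring
  rw [e, hs, h2]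
  field_simp
  ring

/-- Every symbol with a unit in the second place is trivial or unramified. -/
theorem exists_serreSymbol_unit {p : v.valuationSubring} (hp : Irreducible p) {u : Kˣ}
    (hu : W.base (u : K) = 1) (n : ℕ) (a : K) (ha : W.base a ≤ (W.base (p : K) ^ n)⁻¹) :
    serreSymbol a u = 1 ∨ ∃ (a₀ : K) (ϖ : Kˣ), W.base a₀ ≤ 1 ∧ IsUniformizerOf v ϖ ∧
      serreSymbol a u = serreSymbol a₀ ϖ := by
  have hp0 := W.base_irreducible_pos hp
  have hp1 := W.base_irreducible_lt_one hp
  have hpK : (p : K) ≠ 0 := fun h0 => hp.ne_zero (Subtype.ext h0)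
  induction n generalizing a with
  | zero => exact Or.inl (W.serreSymbol_eq_one_of_unit (by simpa using ha) hu)
  | succ n ih =>
    obtain ⟨m, hm | hm⟩ := n.even_or_odd'
    · by_cases hlt : W.base (a * (p : K) ^ (n + 1)) < 1
      · refine ih a ?_
        have h1 := W.base_le_of_lt_one hp hlt
        rw [map_mul, map_pow, pow_succ, ← mul_assoc] at h1
        have h2 := (mul_le_iff_le_one_left hp0).1 h1
        rwa [← one_div, le_div_iff₀ (by positivity)]
      have h1 : W.base (a * (p : K) ^ (n + 1)) = 1 := by
        refine le_antisymm ?_ (not_lt.1 hlt)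
        rw [map_mul, map_pow]
        rwa [← le_div_iff₀ (by positivity), one_div]
      have ha0 : a ≠ 0 := by
        rintro rfl
        simp at h1
      set A : Kˣ := Units.mk0 a ha0
      set P : Kˣ := Units.mk0 (p : K) hpK
      -- Here `a` has a pole of exact order `2m + 1`. Multiplying `u` by `a` and by a square does
      -- not change the symbol and gives valuation `-(2m + 1) + (2m + 2) = 1`.
      have hϖ : IsUniformizerOf v (A * u * (P ^ (m + 1)) ^ 2) := by
        refine W.isUniformizerOf_of_base_eq hp _ ?_
        have e : ((A * u * (P ^ (m + 1)) ^ 2 : Kˣ) : K) = (a * (p : K) ^ (n + 1)) * u * p := by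
          push_cast
          simp only [A, P, Units.val_mk0, hm]
          ring
        rw [e, map_mul, map_mul, h1, hu, one_mul, one_mul]
      have hsym : serreSymbol a u = serreSymbol a (A * u * (P ^ (m + 1)) ^ 2) := by
        rw [serreSymbol_mul_sq, serreSymbol_mul]
        have : serreSymbol a A = 1 := serreSymbol_self A
        rw [this, one_mul]
      obtain ⟨N, hN⟩ : ∃ N : ℕ, W.base a ≤
          (W.base ((A * u * (P ^ (m + 1)) ^ 2 : Kˣ) : K) ^ N)⁻¹ := by
        refine ⟨n + 1, ?_⟩
        have e : ((A * u * (P ^ (m + 1)) ^ 2 : Kˣ) : K) = (a * (p : K) ^ (n + 1)) * u * p := by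
          push_cast
          simp only [A, P, Units.val_mk0, hm]
          ring
        rwa [e, map_mul, map_mul, h1, hu, one_mul, one_mul]
      obtain ⟨a₀, ha₀, h⟩ := W.exists_serreSymbol_uniformizer hϖ N a hN
      exact Or.inr ⟨a₀, _, ha₀, hϖ, hsym.trans h⟩
    · obtain ⟨a', ha', h⟩ := W.exists_reduce_even hp (a := a) (m := m)
        (by rwa [show 2 * (m + 1) = n + 1 by omega])
      rw [h u]
      exact ih a' (by rwa [hm])

/-- Up to the square of a power of `p`, the element `b` is a unit or a uniformizer. -/
theorem exists_serreSymbol (W : ExtVal v) {p : v.valuationSubring} (hp : Irreducible p) (a : K)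
    (b : Kˣ) :
    serreSymbol a b = 1 ∨ ∃ (a₀ : K) (ϖ : Kˣ), W.base a₀ ≤ 1 ∧ IsUniformizerOf v ϖ ∧
      serreSymbol a b = serreSymbol a₀ ϖ := by
  have hp0 := W.base_irreducible_pos hp
  have hp1 := W.base_irreducible_lt_one hp
  have hpK : (p : K) ≠ 0 := fun h0 => hp.ne_zero (Subtype.ext h0)
  set P : Kˣ := Units.mk0 (p : K) hpK with hP
  obtain ⟨N, hN⟩ : ∃ N : ℕ, W.base a ≤ (W.base (p : K) ^ N)⁻¹ := by
    by_cases ha : a = 0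
    · exact ⟨0, by simp [ha]⟩
    · obtain ⟨N, hN⟩ := NNReal.exists_pow_lt_of_lt_one
        (inv_pos.2 ((Valuation.pos_iff W.base).2 ha)) hp1
      refine ⟨N, ?_⟩
      rw [le_inv_comm₀ ((Valuation.pos_iff W.base).2 ha) (by positivity)]
      exact hN.le
  obtain ⟨n, hn⟩ := W.exists_base_eq_zpow hp b.ne_zero
  obtain ⟨m, hm | hm⟩ := n.even_or_odd'
  · have h1 := W.exists_serreSymbol_unit hp (u := b * (P ^ (-m)) ^ 2) (by
      push_cast
      rw [map_mul, hn, map_pow, map_zpow₀, hP, Units.val_mk0, ← zpow_natCast, ← zpow_mul,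
        ← zpow_add₀ hp0.ne', hm, show 2 * m + -m * ((2 : ℕ) : ℤ) = 0 by push_cast; ring, zpow_zero])
      N a hN
    rwa [serreSymbol_mul_sq] at h1
  · have hval : W.base ((b * (P ^ (-m)) ^ 2 : Kˣ) : K) = W.base (p : K) := by
      push_cast
      rw [map_mul, hn, map_pow, map_zpow₀, hP, Units.val_mk0, ← zpow_natCast, ← zpow_mul,
        ← zpow_add₀ hp0.ne', hm, show 2 * m + 1 + -m * ((2 : ℕ) : ℤ) = 1 by push_cast; ring,
        zpow_one]
    have hϖ := W.isUniformizerOf_of_base_eq hp _ hval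
    obtain ⟨a₀, ha₀, h⟩ := W.exists_serreSymbol_uniformizer hϖ N a (by rwa [hval])
    rw [serreSymbol_mul_sq] at h
    exact Or.inr ⟨a₀, _, ha₀, hϖ, h⟩

/-- Every nontrivial symbol has a local invariant. -/
theorem exists_hasInvariant_serreSymbol (W : ExtVal v) {p : v.valuationSubring} (hp : Irreducible p)
    (a : K) (b : Kˣ) (h : serreSymbol a b ≠ 1) : ∃ c, HasInvariant v (serreSymbol a b) c := by
  obtain ⟨a₀, ϖ, ha₀, hϖ, h0⟩ := (W.exists_serreSymbol hp a b).resolve_left h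
  have hnt : ∃ σ, (artinSchreierChar a₀).toHom σ ≠ 1 := by
    by_contra! hcon
    exact h (h0.trans (GalChar.cup_eq_one_of_trivial _ hcon ϖ))
  obtain ⟨s, hs⟩ := hnt
  exact ⟨_, artinSchreierChar a₀, ϖ, s, W.isUnramified_artinSchreierChar ha₀ ⟨s, hs⟩, hϖ,
    W.isFrobenius_artinSchreierChar ha₀ hs, rfl, h0⟩

/-- The local invariant of a symbol vanishes if and only if the symbol is trivial. -/
theorem localSymbol_eq_zero_iff (W : ExtVal v) {p : v.valuationSubring} (hp : Irreducible p)
    (a : K) (b : Kˣ) : localSymbol v a b = 0 ↔ serreSymbol a b = 1 := by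
  classical
  have h01 : localSymbol v a b = 0 ↔ localInvariant v (serreSymbol a b) = 0 := by
    rw [localSymbol]
    split_ifs with h <;> simp [h]
  rw [h01]
  constructor
  · intro h
    by_contra hne
    -- This excludes that the invariant is zero only by its default value.
    have hex := W.exists_hasInvariant_serreSymbol hp a b hne
    rw [localInvariant, dif_pos hex] at h
    obtain ⟨χ, ϖ, F, hχ, hϖ, hF, hc, hx⟩ := hex.choose_spec
    rw [h] at hc
    exact hne (hx.trans (χ.cup_eq_one_of_trivial
      (W.eq_one_of_isFrobenius hp hχ hF (toAdd_eq_zero.1 hc)) ϖ))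
  · intro h
    rw [localInvariant]
    split_ifs with hex
    · obtain ⟨χ, ϖ, F, hχ, hϖ, hF, hc, hx⟩ := hex.choose_spec
      rw [← hc, W.eq_one_of_cup_eq_one hχ hϖ (hx.symm.trans h) F, toAdd_one]
    · rfl

end CharTwo

end ExtVal

/-! ## Complete fields -/

section Complete

open scoped NNReal

/-- The spectral norm extends the valuation of a complete field to its separable closure. -/
def ExtVal.ofNormedField {K : Type*} [NontriviallyNormedField K] [IsUltrametricDist K]
    [CompleteSpace K] {Γ : Type*} [LinearOrderedCommGroupWithZero Γ] (v : Valuation K Γ)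
    (hv : ∀ x, v x ≤ 1 ↔ ‖x‖ ≤ 1) : ExtVal v where
  w :=
    { toFun := fun x => ⟨spectralNorm K (SepCl K) x, spectralNorm_nonneg x⟩
      map_zero' := Subtype.ext spectralNorm_zero
      map_one' := Subtype.ext spectralNorm_one
      map_mul' := fun x y => Subtype.ext (spectralAlgNorm_mul x y)
      map_add_le_max' := fun x y => isNonarchimedean_spectralNorm x y }
  map_galois := fun σ x => Subtype.ext (spectralNorm_eq_of_equiv σ x).symm
  le_one_iff := fun x => by
    change spectralNorm K (SepCl K) x ≤ 1 ↔ _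
    have hxK : IsIntegral K x := Algebra.IsIntegral.isIntegral x
    rw [spectralNorm, spectralValue_le_one_iff (minpoly.monic hxK)]
    constructor
    · intro h
      have hlift : minpoly K x ∈ Polynomial.lifts (algebraMap v.valuationSubring K) := by
        rw [Polynomial.lifts_iff_coeff_lifts]
        exact fun n => ⟨⟨(minpoly K x).coeff n, (hv _).2 (h n)⟩, rfl⟩
      obtain ⟨q, hq, -, hqm⟩ := Polynomial.lifts_and_degree_eq_and_monic hlift
        (minpoly.monic hxK)
      refine ⟨q, hqm, ?_⟩
      rw [IsScalarTower.algebraMap_eq v.valuationSubring K (SepCl K), ← eval₂_map, hq]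
      exact minpoly.aeval K x
    · intro h n
      rw [minpoly.isIntegrallyClosed_eq_field_fractions' K h, coeff_map]
      exact (hv _).1 ((minpoly v.valuationSubring x).coeff n).2
  mem_range_of_approx := fun z hz => by
    let := spectralNorm.normedField K (SepCl K)
    have hiso : Isometry (algebraMap K (SepCl K)) :=
      AddMonoidHomClass.isometry_of_norm (algebraMap K (SepCl K))
        (fun x => spectralNorm_extends x)
    have hcl : IsClosed (Set.range (algebraMap K (SepCl K))) :=
      -- An isometric image of a complete space is closed.
      hiso.isClosedEmbedding.isClosed_range
    rw [← hcl.closure_eq, Metric.mem_closure_iff]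
    intro ε hε
    obtain ⟨a, ha⟩ := hz ⟨ε, hε.le⟩ hε
    exact ⟨_, ⟨a, rfl⟩, ha⟩

/-- A nontrivial valuation with values in `ℤᵐ⁰` has rank one. -/
abbrev Valuation.rankOneOfIsNontrivial {R : Type*} [Ring R] (v : Valuation R ℤᵐ⁰) [v.IsNontrivial] :
    v.RankOne where
  hom' := (WithZeroMulInt.toNNReal (e := 2) two_ne_zero).comp
    MonoidWithZeroHom.ValueGroup₀.embedding
  strictMono' := (WithZeroMulInt.toNNReal_strictMono one_lt_two).comp
    MonoidWithZeroHom.ValueGroup₀.embedding_strictMono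

theorem Valuation.isUnit_valuationSubring_iff {K : Type*} [Field K] {Γ : Type*}
    [LinearOrderedCommGroupWithZero Γ] (v : Valuation K Γ) (x : v.valuationSubring) :
    IsUnit x ↔ v (x : K) = 1 := by
  constructor
  · rintro ⟨u, rfl⟩
    have h1 : v ((u : v.valuationSubring) : K) ≤ 1 := (u : v.valuationSubring).2
    have h2 : v (((u⁻¹ : (v.valuationSubring)ˣ) : v.valuationSubring) : K) ≤ 1 :=
      ((u⁻¹ : (v.valuationSubring)ˣ) : v.valuationSubring).2
    have h3 : ((u : v.valuationSubring) : K) *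
        (((u⁻¹ : (v.valuationSubring)ˣ) : v.valuationSubring) : K) = 1 := by
      rw [← MulMemClass.coe_mul, Units.mul_inv, OneMemClass.coe_one]
    have h4 := congrArg v h3
    rw [map_mul, map_one] at h4
    refine le_antisymm h1 ?_
    rw [← h4]
    exact mul_le_of_le_one_right' h2
  · intro h
    have hx : (x : K) ≠ 0 := by
      intro h0
      rw [h0, map_zero] at h
      exact zero_ne_one h
    have h1 : v (x : K)⁻¹ ≤ 1 := by rw [map_inv₀, h, inv_one]
    refine IsUnit.of_mul_eq_one ⟨(x : K)⁻¹, h1⟩ ?_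
    ext1
    exact mul_inv_cancel₀ hx

theorem Valuation.finite_residueField {K : Type*} [Field K] {Γ : Type*}
    [LinearOrderedCommGroupWithZero Γ] (v : Valuation K Γ) {S : Set K} (hS : S.Finite)
    (hrep : ∀ x, v x ≤ 1 → ∃ s ∈ S, v (s - x) < 1) :
    Finite (IsLocalRing.ResidueField v.valuationSubring) := by
  classical
  have := hS.to_subtype
  let f : S → IsLocalRing.ResidueField v.valuationSubring := fun s =>
    -- Elements of `S` need not be integral; the value `0` only makes `f` total.
    if h : (s : K) ∈ v.valuationSubring then
      IsLocalRing.residue v.valuationSubring ⟨_, h⟩ else 0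
  refine Finite.of_surjective f (fun c => ?_)
  obtain ⟨x, rfl⟩ := IsLocalRing.residue_surjective c
  obtain ⟨s, hs, hsx⟩ := hrep x x.2
  have hmem : s ∈ v.valuationSubring := by
    rw [Valuation.mem_valuationSubring_iff, ← sub_add_cancel s (x : K)]
    exact Valuation.map_add_le _ hsx.le x.2
  refine ⟨⟨s, hs⟩, ?_⟩
  simp only [f, dif_pos hmem]
  rw [← sub_eq_zero, ← _root_.map_sub, IsLocalRing.residue_eq_zero_iff,
    IsLocalRing.mem_maximalIdeal, mem_nonunits_iff, v.isUnit_valuationSubring_iff]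
  exact hsx.ne

/-- Non-units have value at most `exp (-1)`, so a product of two has value at most `exp (-2)`. -/
theorem Valuation.irreducible_of_eq_exp_neg_one {K : Type*} [Field K] (v : Valuation K ℤᵐ⁰)
    {p : v.valuationSubring} (hp : v (p : K) = WithZero.exp (-1 : ℤ)) : Irreducible p := by
  have hlt : ∀ a : v.valuationSubring, ¬ IsUnit a → v (a : K) ≤ WithZero.exp (-1 : ℤ) := by
    intro a ha
    have h1 : v (a : K) < WithZero.exp 0 :=
      lt_of_le_of_ne a.2 (fun h => ha ((v.isUnit_valuationSubring_iff a).2 h))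
    rcases eq_or_ne (v (a : K)) 0 with h0 | h0
    · rw [h0]; exact zero_le
    · rw [← WithZero.exp_log h0] at h1 ⊢
      rw [WithZero.exp_lt_exp] at h1
      rw [WithZero.exp_le_exp]
      omega
  constructor
  · rw [v.isUnit_valuationSubring_iff, hp, ← WithZero.exp_zero, WithZero.exp_inj]
    norm_num
  · intro a b hab
    by_contra! hcon
    have h1 := hlt a hcon.1
    have h2 := hlt b hcon.2
    have h3 : v (p : K) = v (a : K) * v (b : K) := by rw [hab, MulMemClass.coe_mul, map_mul]
    rw [hp] at h3
    have h4 : WithZero.exp (-1 : ℤ) ≤ WithZero.exp (-1 : ℤ) * WithZero.exp (-1 : ℤ) :=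
      h3.trans_le (mul_le_mul' h1 h2)
    rw [← WithZero.exp_add, WithZero.exp_le_exp] at h4
    norm_num at h4

end Complete

/-! ## The completions of `𝔽₂(t)` -/

namespace Place

theorem complVal_embed (ω : Place) (x : F2t) : ω.complVal (ω.embed x) = ω.valuation x :=
  Valued.valuedCompletion_apply (K := WithVal ω.valuation) ((WithVal.equiv ω.valuation).symm x)

theorem exists_valuation_eq (ω : Place) : ∃ x : F2t, ω.valuation x = WithZero.exp (-1 : ℤ) := by
  classical
  cases ω with
  | finite P => exact P.valuation_exists_uniformizer F2t
  | infinity => exact ⟨1 / RatFunc.X, RatFunc.inftyValuation.X_inv (ZMod 2)⟩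

theorem exists_irreducible (ω : Place) : ∃ p : ω.complVal.valuationSubring, Irreducible p := by
  obtain ⟨x, hx⟩ := ω.exists_valuation_eq
  rw [← complVal_embed] at hx
  have hmem : ω.embed x ∈ ω.complVal.valuationSubring := by
    rw [Valuation.mem_valuationSubring_iff, hx, ← WithZero.exp_zero, WithZero.exp_le_exp]
    norm_num
  exact ⟨⟨_, hmem⟩, ω.complVal.irreducible_of_eq_exp_neg_one hx⟩

/-- The extension of the valuation of the completion to its separable closure. -/
def extVal (ω : Place) : ExtVal ω.complVal := by
  haveI : (Valued.v : Valuation ω.valuation.Completion ℤᵐ⁰).IsNontrivial := by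
    obtain ⟨x, hx⟩ := ω.exists_valuation_eq
    rw [← complVal_embed] at hx
    refine ⟨ω.embed x, ?_, ?_⟩
    · change ω.complVal (ω.embed x) ≠ 0
      rw [hx]
      exact WithZero.exp_ne_zero
    · change ω.complVal (ω.embed x) ≠ 1
      rw [hx, ← WithZero.exp_zero, Ne, WithZero.exp_inj]
      norm_num
  letI := Valuation.rankOneOfIsNontrivial (Valued.v : Valuation ω.valuation.Completion ℤᵐ⁰)
  letI : NontriviallyNormedField ω.valuation.Completion :=
    Valued.toNontriviallyNormedField _ ℤᵐ⁰
  haveI : IsUltrametricDist ω.valuation.Completion := Valued.instIsUltrametricDist _ ℤᵐ⁰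
  haveI : CompleteSpace ω.valuation.Completion := UniformSpace.Completion.completeSpace _
  exact ExtVal.ofNormedField (Valued.v : Valuation ω.valuation.Completion ℤᵐ⁰)
    (fun x => Valued.toNormedField.norm_le_one_iff.symm)

theorem exists_embed_sub_lt_one (ω : Place) (x : ω.completion) :
    ∃ y : F2t, ω.complVal (x - ω.embed y) < 1 := by
  let x' : ω.valuation.Completion := x
  have hopen : IsOpen {z : ω.valuation.Completion | Valued.v (x' - z) < (1 : ℤᵐ⁰)} := by
    have h := (Valued.isOpen_ball ω.valuation.Completion 1).preimage
      (continuous_const.sub continuous_id : Continuous fun z => x' - z)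
    simp only [Valuation.restrict_lt_one_iff] at h
    exact h
  obtain ⟨y, hy⟩ := (UniformSpace.Completion.denseRange_coe
    (α := WithVal ω.valuation)).exists_mem_open hopen ⟨x', by simp⟩
  exact ⟨WithVal.equiv ω.valuation y, hy⟩

theorem finite_quotient_of_ne_bot {F : Type*} [Field F] [Finite F] {I : Ideal F[X]} (hI : I ≠ ⊥) :
    Finite (F[X] ⧸ I) := by
  obtain ⟨g, rfl⟩ := IsPrincipalIdealRing.principal I
  have hg : g ≠ 0 := by
    rintro rfl
    simp at hI
  have : Module.Finite F (AdjoinRoot g) := (AdjoinRoot.powerBasis hg).finite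
  exact Module.finite_of_finite F (M := AdjoinRoot g)

/-- Finitely many elements of `𝔽₂(t)` represent all residue classes. -/
theorem exists_finite_representatives (ω : Place) :
    ∃ S : Set F2t, S.Finite ∧ ∀ y, ω.valuation y ≤ 1 → ∃ s ∈ S, ω.valuation (s - y) < 1 := by
  classical
  cases ω with
  | finite P =>
    have := finite_quotient_of_ne_bot P.ne_bot
    refine ⟨Set.range fun c : (ZMod 2)[X] ⧸ P.asIdeal =>
      algebraMap (ZMod 2)[X] F2t (Quotient.out c), Set.finite_range _, fun y hy => ?_⟩
    obtain ⟨a, ha⟩ := P.exists_valuation_sub_lt_of_integer hy 1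
    refine ⟨_, ⟨Ideal.Quotient.mk P.asIdeal a, rfl⟩, ?_⟩
    have h1 : P.valuation F2t (algebraMap (ZMod 2)[X] F2t
        (Quotient.out (Ideal.Quotient.mk P.asIdeal a) - a)) < 1 := by
      rw [P.valuation_lt_one_iff_mem, ← Ideal.Quotient.eq]
      exact Quotient.out_eq _
    rw [map_sub] at h1
    have h2 := Valuation.map_add_lt _ h1 ha
    rwa [sub_add_sub_cancel] at h2
  | infinity =>
    refine ⟨{0, 1}, Set.toFinite _, fun y hy => ?_⟩
    change RatFunc.inftyValuation (ZMod 2) y ≤ 1 at hy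
    change ∃ s ∈ ({0, 1} : Set F2t), RatFunc.inftyValuation (ZMod 2) (s - y) < 1
    by_cases hlt : RatFunc.inftyValuation (ZMod 2) y < 1
    · exact ⟨0, by simp, by rwa [zero_sub, Valuation.map_neg]⟩
    have h1 := le_antisymm hy (not_lt.1 hlt)
    have hy0 : y ≠ 0 := by
      rintro rfl
      simp at h1
    -- A unit at infinity has numerator and denominator of equal degree, with the same leading
    -- coefficient `1` over `𝔽₂`, so the numerator of `1 - y` drops in degree.
    refine ⟨1, by simp, ?_⟩
    rw [RatFunc.inftyValuation_apply, RatFunc.inftyValuation_of_nonzero (ZMod 2) hy0,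
      ← WithZero.exp_zero, WithZero.exp_inj, RatFunc.intDegree, sub_eq_zero] at h1
    have hdeg : y.num.natDegree = y.denom.natDegree := by exact_mod_cast h1
    have hnum : y.num ≠ 0 := RatFunc.num_ne_zero hy0
    have hden : y.denom ≠ 0 := y.denom_ne_zero
    have hlc : ∀ c : ZMod 2, c ≠ 0 → c = 1 := by decide
    have hsub : (y.denom - y.num).degree < y.denom.degree :=
      degree_sub_lt_left (by rw [degree_eq_natDegree hden, degree_eq_natDegree hnum, hdeg]) hden
        (by rw [hlc _ (leadingCoeff_ne_zero.2 hnum), hlc _ (leadingCoeff_ne_zero.2 hden)])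
    have hden' : algebraMap (ZMod 2)[X] F2t y.denom ≠ 0 := by
      simpa using hden
    have e : 1 - y = algebraMap (ZMod 2)[X] F2t (y.denom - y.num) /
        algebraMap (ZMod 2)[X] F2t y.denom := by
      conv_lhs => rw [← RatFunc.num_div_denom y]
      rw [map_sub, sub_div, div_self hden']
    by_cases h0 : y.denom - y.num = 0
    · rw [e, h0]
      simp
    · rw [e, map_div₀, RatFunc.inftyValuation_apply, RatFunc.inftyValuation_apply,
        RatFunc.inftyValuation.polynomial (ZMod 2) h0,
        RatFunc.inftyValuation.polynomial (ZMod 2) hden, ← WithZero.exp_sub, ← WithZero.exp_zero,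
        WithZero.exp_lt_exp]
      have := natDegree_lt_natDegree h0 hsub
      omega

instance finite_residueField (ω : Place) :
    Finite (IsLocalRing.ResidueField ω.complVal.valuationSubring) := by
  obtain ⟨S, hS, hrep⟩ := ω.exists_finite_representatives
  refine ω.complVal.finite_residueField (hS.image ω.embed) (fun x hx => ?_)
  obtain ⟨y, hy⟩ := ω.exists_embed_sub_lt_one x
  have hy1 : ω.valuation y ≤ 1 := by
    rw [← complVal_embed, ← sub_sub_cancel x (ω.embed y)]
    exact Valuation.map_sub_le _ hx hy.le
  obtain ⟨s, hs, hsy⟩ := hrep y hy1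
  refine ⟨_, ⟨s, hs, rfl⟩, ?_⟩
  rw [← complVal_embed, map_sub] at hsy
  rw [Valuation.map_sub_swap] at hy
  have := Valuation.map_add_lt _ hsy hy
  rwa [sub_add_sub_cancel] at this

end Place

/-! ## The conic and the norm form -/

section Conic

variable {F : Type*} [Field F]

theorem conicPoints_nonempty_iff (t y : F) :
    (conicPoints t y).Nonempty ↔
      ∃ x : Fin 3 → F, x ≠ 0 ∧ x 0 ^ 2 + x 0 * x 1 + y * x 1 ^ 2 = t * x 2 ^ 2 := by
  constructor
  · rintro ⟨P, hP⟩
    exact ⟨P.rep, P.rep_nonzero, hP⟩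
  · rintro ⟨x, hx, h⟩
    refine ⟨Projectivization.mk F x hx, ?_⟩
    obtain ⟨a, ha⟩ := Projectivization.exists_smul_eq_mk_rep F x hx
    have hi : ∀ i, (Projectivization.mk F x hx).rep i = a * x i := fun i => by
      rw [← ha]
      rfl
    change _ = _
    rw [hi, hi, hi]
    linear_combination (a : F) ^ 2 * h

/-- The conic has a rational point if and only if `t` is represented by the norm form. -/
theorem conicPoints_nonempty_iff_normForm [CharP F 2] (t y : F) :
    (conicPoints t y).Nonempty ↔ ∃ a b : F, a ^ 2 + a * b + y * b ^ 2 = t := by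
  rw [conicPoints_nonempty_iff]
  constructor
  · rintro ⟨x, hx, h⟩
    -- A point with `x₂ = 0` has `x₁ ≠ 0`, and `x₀/x₁` is a root of `X² - X - y`.
    by_cases h2 : x 2 = 0
    · rw [h2] at h
      have h1 : x 1 ≠ 0 := by
        intro h1
        rw [h1] at h
        have h0 : x 0 = 0 := by simpa using h
        exact hx (by ext i; fin_cases i <;> simp [h0, h1, h2])
      refine exists_normForm_of_root (β := x 0 / x 1) ?_ t
      have h2 : (2 : F) = 0 := CharTwo.two_eq_zero
      field_simp
      linear_combination h - (x 0 * x 1 + y * x 1 ^ 2) * h2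
    · refine ⟨x 0 / x 2, x 1 / x 2, ?_⟩
      field_simp
      linear_combination h
  · rintro ⟨a, b, h⟩
    refine ⟨![a, b, 1], fun h0 => ?_, by simpa using h⟩
    have := congrFun h0 2
    simp at this

theorem monic_artinSchreierPoly (y : F) : (X ^ 2 - X - C y : F[X]).Monic := by
  monicity!

theorem natDegree_artinSchreierPoly (y : F) : (X ^ 2 - X - C y : F[X]).natDegree = 2 := by
  compute_degree!

/-- The basis `1, a` of the Artin–Schreier algebra. -/
def artinSchreierBasis (y : F) : Module.Basis (Fin 2) F (ArtinSchreierAlg y) :=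
  (AdjoinRoot.powerBasis' (monic_artinSchreierPoly y)).basis.reindex
    (finCongr (natDegree_artinSchreierPoly y))

theorem artinSchreierBasis_zero (y : F) : artinSchreierBasis y 0 = 1 := by
  rw [artinSchreierBasis, Module.Basis.reindex_apply, PowerBasis.basis_eq_pow]
  exact pow_zero _

theorem artinSchreierBasis_one (y : F) :
    artinSchreierBasis y 1 = AdjoinRoot.root (X ^ 2 - X - C y) := by
  rw [artinSchreierBasis, Module.Basis.reindex_apply, PowerBasis.basis_eq_pow]
  exact pow_one _

theorem root_artinSchreierAlg (y : F) :
    AdjoinRoot.root (X ^ 2 - X - C y) * AdjoinRoot.root (X ^ 2 - X - C y) =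
      AdjoinRoot.root (X ^ 2 - X - C y) + algebraMap F (ArtinSchreierAlg y) y := by
  have h := AdjoinRoot.eval₂_root (X ^ 2 - X - C y)
  simp only [eval₂_sub, eval₂_X_pow, eval₂_X, eval₂_C] at h
  rw [AdjoinRoot.algebraMap_eq]
  linear_combination h

/-- The determinant of multiplication in the basis `1, α`, using `α² = α + y`; the sign of `y`
disappears only in characteristic two. -/
theorem norm_artinSchreierAlg (y a b : F) :
    Algebra.norm F (a • artinSchreierBasis y 0 + b • artinSchreierBasis y 1) =
      a ^ 2 + a * b - y * b ^ 2 := by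
  set e := artinSchreierBasis y with he
  have h0 : (a • e 0 + b • e 1) * e 0 = a • e 0 + b • e 1 := by
    rw [he, artinSchreierBasis_zero, mul_one]
  have h1 : (a • e 0 + b • e 1) * e 1 = (y * b) • e 0 + (a + b) • e 1 := by
    have hr := root_artinSchreierAlg y
    rw [he, artinSchreierBasis_zero, artinSchreierBasis_one]
    simp only [Algebra.smul_def, mul_one, map_mul, map_add]
    linear_combination algebraMap F (ArtinSchreierAlg y) b * hr
  rw [Algebra.norm_eq_matrix_det e, Matrix.det_fin_two]
  simp only [Algebra.leftMulMatrix_eq_repr_mul, h0, h1, map_add, map_smul, Module.Basis.repr_self,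
    Finsupp.add_apply, Finsupp.smul_apply, Finsupp.single_apply, smul_eq_mul]
  simp
  ring

theorem exists_norm_eq_iff [CharP F 2] (t y : F) :
    (∃ z : ArtinSchreierAlg y, Algebra.norm F z = t) ↔
      ∃ a b : F, a ^ 2 + a * b + y * b ^ 2 = t := by
  have hnorm : ∀ a b : F, Algebra.norm F (a • artinSchreierBasis y 0 + b • artinSchreierBasis y 1) =
      a ^ 2 + a * b + y * b ^ 2 := fun a b => by
    rw [norm_artinSchreierAlg, CharTwo.sub_eq_add]
  constructor
  · rintro ⟨z, hz⟩
    refine ⟨(artinSchreierBasis y).repr z 0, (artinSchreierBasis y).repr z 1, ?_⟩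
    rw [← hnorm, ← hz, ← Fin.sum_univ_two
      (fun i => (artinSchreierBasis y).repr z i • artinSchreierBasis y i),
      Module.Basis.sum_repr]
  · rintro ⟨a, b, h⟩
    exact ⟨_, (hnorm a b).trans h⟩

end Conic

end

theorem proposition3 (ω : Place) (y : ω.completion) :
    ((conicPoints (ω.t : ω.completion) y).Nonempty ↔ localSymbol ω.complVal y ω.t = 0) ∧
      (localSymbol ω.complVal y ω.t = 0 ↔
        ∃ z : ArtinSchreierAlg y, Algebra.norm ω.completion z = (ω.t : ω.completion)) := by
  obtain ⟨p, hp⟩ := ω.exists_irreducible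
  rw [conicPoints_nonempty_iff_normForm, exists_norm_eq_iff, ω.extVal.localSymbol_eq_zero_iff hp,
    serreSymbol_eq_one_iff]
  exact ⟨Iff.rfl, Iff.rfl⟩
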